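/- All graphs are finite; multiple edges are allowed, loops are not. A cycle is a connected 2-regular graph (two vertices joined by two parallel edges form a cycle), and a graph is eulerian if every vertex has even degree (it need not be connected). A 3-row graph $R$ with $s$ columns is a graph with vertex set $\{v_{ij} : 1\le i\le 3,\ 1\le j\le s\}$ in which every column $C_j=\{v_{1j},v_{2j},v_{3j}\}$ is an independent set; $R_C$ denotes the graph obtained from $R$ by identifying, for each $j$, the three vertices of $C_j$ to a single vertex $c_j$. An amiable coloring of $R$ is a pair $(f,g)$ of a (not necessarily proper) vertex coloring $f:V(R)\to\{1,2,3\}$ and a (not necessarily proper) edge coloring $g:E(R)\to\{1,2,3\}$ such that (i) $f(v)\ne f(w)$ for any two distinct vertices $v,w$ of the same column; (ii) $f(v)\neq g(e)$ for every vertex $v$ and every edge $e$ incident with $v$; (iii) for every color $i\in\{1,2,3\}$ and every $j$, the sum $d_i(v_{1j})+d_i(v_{2j})+d_i(v_{3j})$ is even, where $d_i(v)$ is the number of edges of color $i$ incident with $v$. A Kotzig graph is a cubic graph that has a proper 3-edge-coloring in which every cycle whose edges have at most two colors is hamiltonian. A subdivision of a graph $H$ is obtained from $H$ by replacing at least one edge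 $vw$ by a $vw$-path of length at least 2. A Kotzig-frame of a cubic graph $G$ is a spanning subgraph $F$ of $G$ such that every component of $F$ has an even number of vertices and is either a cycle or a subdivision of a Kotzig graph. A graph is cyclically 4-edge-connected if it is connected and every edge cut both sides of which contain a cycle has at least 4 edges. A cycle double cover of $G$ is a set of cycles of $G$ such that every edge of $G$ is contained in precisely two of them. Corollary. Suppose that every 3-row graph $R$ for which $R_C$ is eulerian has an amiable coloring, and that every cyclically 4-edge-connected cubic graph has a Kotzig-frame. Then every 2-connected cubic graph has a cycle double cover. -/

import Mathlib

/-!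
Multigraphs are Mathlib's `Graph α β`: vertices form a set `V(G) : Set α`, edges a set
`E(G) : Set β`, parallel edges are allowed, and `H ≤ G` means that `H` is a subgraph of `G`.
-/

universe u v

namespace Graph

/-- `G` has finitely many vertices and finitely many edges. -/
def IsFinite {α : Type u} {β : Type v} (G : Graph α β) : Prop :=
  V(G).Finite ∧ E(G).Finite

/-- The degree of `x` in `G`: the number of edges incident with `x`, loops counted twice. -/
noncomputable def degree {α : Type u} {β : Type v} (G : Graph α β) (x : α) : ℕ :=
  (G.incidenceSet x).ncard + (G.loopSet x).ncard

/-- `G` is connected: it has a vertex, and any two vertices are joined by a walk. -/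
def IsConnected {α : Type u} {β : Type v} (G : Graph α β) : Prop :=
  V(G).Nonempty ∧ ∀ x ∈ V(G), ∀ y ∈ V(G), Relation.ReflTransGen G.Adj x y

/-- `G` is 2-connected: it is connected, has at least two vertices and no cut vertex.
(A connected graph has a vertex, so the second clause forces a second vertex.) -/
def IsTwoConnected {α : Type u} {β : Type v} (G : Graph α β) : Prop :=
  G.IsConnected ∧ ∀ x ∈ V(G), (G.deleteVerts {x}).IsConnected

/-- A cubic graph: a finite loopless multigraph in which every vertex has degree 3. -/
def IsCubic {α : Type u} {β : Type v} (G : Graph α β) : Prop :=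
  G.IsFinite ∧ G.Loopless ∧ ∀ x ∈ V(G), G.degree x = 3

/-- An eulerian graph: every vertex has even degree (connectedness is not required). -/
def IsEulerian {α : Type u} {β : Type v} (G : Graph α β) : Prop :=
  ∀ x ∈ V(G), Even (G.degree x)

/-- A cycle: a finite connected 2-regular graph (two vertices joined by two parallel edges
form a cycle). -/
def IsCycle {α : Type u} {β : Type v} (C : Graph α β) : Prop :=
  C.IsFinite ∧ C.IsConnected ∧ ∀ x ∈ V(C), C.degree x = 2

/-- `P` is a path with the two distinct end vertices `x` and `y`. -/
def IsPathBetween {α : Type u} {β : Type v} (P : Graph α β) (x y : α) : Prop :=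
  P.IsFinite ∧ P.IsConnected ∧ x ≠ y ∧ x ∈ V(P) ∧ y ∈ V(P) ∧
    P.degree x = 1 ∧ P.degree y = 1 ∧ ∀ z ∈ V(P), z ≠ x → z ≠ y → P.degree z = 2

/-- `L` is a component of `F`: a maximal connected subgraph. -/
def IsComponent {α : Type u} {β : Type v} (L F : Graph α β) : Prop :=
  Maximal (fun H : Graph α β => H ≤ F ∧ H.IsConnected) L

/-- The edge cut of `G` determined by `X`: the edges with one end in `X` and the other end
outside `X`. -/
def edgeCut {α : Type u} {β : Type v} (G : Graph α β) (X : Set α) : Set β :=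
  {e | ∃ x ∈ X, ∃ y ∉ X, G.IsLink e x y}

/-- `G` is cyclically `k`-edge-connected: it is connected, and every edge cut such that both
sides contain a cycle has at least `k` edges. -/
def IsCyclicallyEdgeConnected {α : Type u} {β : Type v} (G : Graph α β) (k : ℕ) : Prop :=
  G.IsConnected ∧ ∀ X ⊆ V(G),
    (∃ C ≤ G, C.IsCycle ∧ V(C) ⊆ X) → (∃ C ≤ G, C.IsCycle ∧ V(C) ⊆ V(G) \ X) →
      k ≤ (G.edgeCut X).ncard

/-- A set `S` of cycles of `G` such that every edge of `G` is contained in precisely two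
cycles of `S`. -/
def IsCycleDoubleCover {α : Type u} {β : Type v} (G : Graph α β) (S : Set (Graph α β)) : Prop :=
  (∀ C ∈ S, C ≤ G ∧ C.IsCycle) ∧ ∀ e ∈ E(G), {C | C ∈ S ∧ e ∈ E(C)}.ncard = 2

/-- `c` is a Kotzig-coloring of `K`: a proper 3-edge-coloring such that each cycle of `K` whose
edges have at most two colors is hamiltonian. -/
def IsKotzigColoring {α : Type u} {β : Type v} (K : Graph α β) (c : β → Fin 3) : Prop :=
  (∀ x e f, K.Inc e x → K.Inc f x → e ≠ f → c e ≠ c f) ∧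
    ∀ C ≤ K, C.IsCycle → (∃ a b, ∀ e ∈ E(C), c e = a ∨ c e = b) → V(C) = V(K)

/-- A Kotzig graph: a cubic graph that admits a Kotzig-coloring. -/
def IsKotzig {α : Type u} {β : Type v} (K : Graph α β) : Prop :=
  K.IsCubic ∧ ∃ c : β → Fin 3, K.IsKotzigColoring c

/-- `K'` is a subdivision of the (loopless) graph `K`: it arises from `K` by replacing each edge
`e` by a path `P e` with the same ends, where the paths are internally disjoint from `K` and from
each other, and at least one of them has length at least 2. (A path `P e` of length 1 means that
`e` is not replaced; its single edge may bear another name.) -/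
def IsSubdivision {α : Type u} {β : Type v} (K' K : Graph α β) : Prop :=
  ∃ P : β → Graph α β,
    (∀ e x y, K.IsLink e x y →
      P e ≤ K' ∧ (P e).IsPathBetween x y ∧ V(P e) ∩ V(K) = {x, y}) ∧
    (∀ e ∈ E(K), ∀ f ∈ E(K), e ≠ f →
      V(P e) ∩ V(P f) ⊆ V(K) ∧ Disjoint E(P e) E(P f)) ∧
    V(K') = V(K) ∪ ⋃ e ∈ E(K), V(P e) ∧
    E(K') = ⋃ e ∈ E(K), E(P e) ∧
    ∃ e ∈ E(K), 2 ≤ E(P e).ncard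

/-- `F` is a Kotzig-frame of the cubic graph `G`: a spanning subgraph every component of which
has an even number of vertices and is a cycle or a subdivision of a Kotzig graph. -/
def IsKotzigFrame {α : Type u} {β : Type v} (G F : Graph α β) : Prop :=
  F ≤s G ∧ ∀ L, L.IsComponent F →
    Even V(L).ncard ∧ (L.IsCycle ∨ ∃ K : Graph α β, K.IsKotzig ∧ L.IsSubdivision K)

/-- `R` is a 3-row graph with `s` columns: a finite multigraph whose vertices are all the pairs
`(i, j)` (row `i`, column `j`) and in which every column is an independent set. In particular
`R` has no loops. -/
def IsThreeRow {s : ℕ} {β : Type v} (R : Graph (Fin 3 × Fin s) β) : Prop :=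
  V(R) = Set.univ ∧ E(R).Finite ∧ ∀ i i' j, ¬ R.Adj (i, j) (i', j)

/-- The graph obtained from `R` by identifying, for each `j`, all vertices of the `j`-th
column. -/
def columnQuotient {s : ℕ} {β : Type v} (R : Graph (Fin 3 × Fin s) β) : Graph (Fin s) β :=
  R.map Prod.snd

/-- The number of edges of color `c` incident with `x` in the loopless edge-colored graph `G`. -/
noncomputable def colorDegree {α : Type u} {β : Type v} (G : Graph α β) (g : β → Fin 3)
    (c : Fin 3) (x : α) : ℕ :=
  {e | G.Inc e x ∧ g e = c}.ncard

/-- `(f, g)` is an amiable coloring of the 3-row graph `R`, where `f` colors the vertices and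
`g` colors the edges. -/
def IsAmiableColoring {s : ℕ} {β : Type v} (R : Graph (Fin 3 × Fin s) β)
    (f : Fin 3 × Fin s → Fin 3) (g : β → Fin 3) : Prop :=
  (∀ j i i', i ≠ i' → f (i, j) ≠ f (i', j)) ∧
    (∀ e x, R.Inc e x → f x ≠ g e) ∧
    ∀ c j, Even (∑ i, R.colorDegree g c (i, j))

end Graph

namespace Graph

open scoped symmDiff

variable {α : Type u} {β : Type v} {G H F : Graph α β}

/-! ### Parity of degrees and edge cuts -/

/-! Instead of cycles it is convenient to cover by even edge sets: a finite indexed family of them,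
possibly with repetitions, that meets each edge twice (`HasEvenDoubleCover`). In a cubic graph an
even set has degree 0 or 2 everywhere, so its nontrivial components are cycles, and
`componentAt_restrict_ne` shows that distinct members never yield the same cycle through a common
edge. Hence such a family gives a cycle double cover, which is a set.

With a Kotzig-frame `F` the family is explicit. Color each component of `F`: a cycle in one color, a
subdivided Kotzig graph by its Kotzig-coloring, carried along the paths. For each color, the
component's edges of the other two colors then form a connected even graph, or there are none.
Contract the components to columns, with the frame color at a vertex of degree 2 as its row. The
remaining edges between different components form a 3-row graph whose column quotient is eulerian,
because the number of edges leaving a component has the parity of three times its even order. An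
amiable coloring permutes the colors inside each component and colors the edges between them; edges
outside `F` within a component take a color missing at both ends. For a color `i`, let `M` be the
non-frame edges of color `i` and `H` the frame edges of the other colors. The ends of `M` lie on `H`
and are even in number in each component, so some `A ⊆ H` has odd degree exactly there. The sets `M
∪ A` and `M ∪ (H \ A)` are even. Over the three colors they cover each non-frame edge twice, and
each frame edge twice because it lies in `H` for two colors (`hasEvenDoubleCover_of_colorings`).

The reduction to cyclically 4-edge-connected graphs is by induction on the order
(`IsTwoEdgeConnected.hasEvenDoubleCover`). A cut of two or three edges with a cycle on each side is
cut open; each side is closed up to a smaller cubic graph, by an extra edge or by an extra vertex.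
The two double covers can be glued because evenness and double covering determine how often each
nonempty trace on the cut occurs (`ncard_trace`). -/

lemma even_ncard_symmDiff {γ : Type*} {A B : Set γ} (hA : A.Finite) (hB : B.Finite) :
    Even (A ∆ B).ncard ↔ (Even A.ncard ↔ Even B.ncard) := by
  have h1 : (A ∆ B).ncard = (A \ B).ncard + (B \ A).ncard :=
    Set.ncard_union_eq (Set.disjoint_left.2 fun x hx hy => hy.2 hx.1) (hA.sdiff) (hB.sdiff)
  have h2 := Set.ncard_inter_add_ncard_sdiff_eq_ncard A B hA
  have h3 := Set.ncard_inter_add_ncard_sdiff_eq_ncard B A hB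
  rw [Set.inter_comm B A] at h3
  rw [h1, ← h2, ← h3]
  simp only [Nat.even_add]
  tauto

/-- The number of edges of `Z` that are incident with `x`. -/
noncomputable def edgeDegree (G : Graph α β) (Z : Set β) (x : α) : ℕ :=
  {e | e ∈ Z ∧ G.Inc e x}.ncard

lemma finite_setOf_inc (hG : G.IsFinite) (Z : Set β) (x : α) :
    {e | e ∈ Z ∧ G.Inc e x}.Finite :=
  hG.2.subset fun _ he => he.2.edge_mem

lemma even_edgeDegree_symmDiff (hG : G.IsFinite) (A B : Set β) (x : α) :
    Even (G.edgeDegree (A ∆ B) x) ↔ (Even (G.edgeDegree A x) ↔ Even (G.edgeDegree B x)) := by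
  rw [edgeDegree, edgeDegree, edgeDegree,
    ← even_ncard_symmDiff (finite_setOf_inc hG _ _) (finite_setOf_inc hG _ _)]
  congr! 2
  ext e
  simp only [Set.mem_symmDiff, Set.mem_ofPred_eq]
  tauto

lemma edgeDegree_union (hG : G.IsFinite) {A B : Set β} (h : Disjoint A B) (x : α) :
    G.edgeDegree (A ∪ B) x = G.edgeDegree A x + G.edgeDegree B x := by
  rw [edgeDegree, edgeDegree, edgeDegree,
    ← Set.ncard_union_eq ?_ (finite_setOf_inc hG _ _) (finite_setOf_inc hG _ _)]
  · congr 1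
    ext e
    simp only [Set.mem_union, Set.mem_ofPred_eq]
    tauto
  · exact Set.disjoint_left.2 fun e he he' => Set.disjoint_left.1 h he.1 he'.1

lemma edgeDegree_edgeSet (G : Graph α β) (x : α) :
    G.edgeDegree E(G) x = (G.incidenceSet x).ncard := by
  unfold edgeDegree incidenceSet
  congr 1
  ext e
  exact ⟨fun h => h.2, fun h => ⟨h.edge_mem, h⟩⟩

lemma not_isLink_self (hl : G.Loopless) {e : β} {x : α} : ¬ G.IsLink e x x :=
  fun h => hl.not_isLoopAt e x h

lemma IsLink.ne_of_loopless (hl : G.Loopless) {e : β} {x y : α} (h : G.IsLink e x y) : x ≠ y := by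
  rintro rfl
  exact not_isLink_self hl h

lemma loopless_of_le (hl : G.Loopless) (h : H ≤ G) : H.Loopless :=
  ⟨fun e x hx => hl.not_isLoopAt e x (hx.mono h)⟩

lemma isFinite_of_le (hG : G.IsFinite) (h : H ≤ G) : H.IsFinite :=
  ⟨hG.1.subset h.vertexSet_mono, hG.2.subset h.edgeSet_mono⟩

lemma degree_eq_ncard_incidenceSet (hl : G.Loopless) (x : α) :
    G.degree x = (G.incidenceSet x).ncard := by
  have : G.loopSet x = ∅ := Set.eq_empty_of_forall_notMem fun e he => hl.not_isLoopAt e x he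
  rw [degree, this, Set.ncard_empty, add_zero]

lemma mem_edgeCut_iff {e : β} {x y : α} (hxy : G.IsLink e x y) (S : Set α) :
    e ∈ G.edgeCut S ↔ (x ∈ S ∧ y ∉ S ∨ y ∈ S ∧ x ∉ S) := by
  constructor
  · rintro ⟨p, hp, q, hq, h⟩
    obtain ⟨rfl, rfl⟩ | ⟨rfl, rfl⟩ := hxy.eq_and_eq_or_eq_and_eq h <;> tauto
  · rintro (⟨h1, h2⟩ | ⟨h1, h2⟩)
    exacts [⟨x, h1, y, h2, hxy⟩, ⟨y, h1, x, h2, hxy.symm⟩]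

/-- This is the handshake argument: an edge of `Z` inside `X` is counted twice and an edge leaving
`X` once. Inductively, adding a vertex changes the cut by the symmetric difference with the edges at
that vertex, which requires that there be no loops. -/
lemma even_sum_edgeDegree_iff (hG : G.IsFinite) (hl : G.Loopless) (Z : Set β) (X : Finset α) :
    Even (∑ x ∈ X, G.edgeDegree Z x) ↔ Even (Z ∩ G.edgeCut X).ncard := by
  classical
  induction X using Finset.induction_on with
  | empty => simp [edgeCut]
  | insert a X ha ih =>
    have hfin : ∀ X, (Z ∩ G.edgeCut X).Finite := fun X =>
      hG.2.subset fun e he => by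
        obtain ⟨-, x, -, y, -, h⟩ := he
        exact h.edge_mem
    rw [Finset.sum_insert ha, Nat.even_add, ih, edgeDegree,
      ← even_ncard_symmDiff (finite_setOf_inc hG _ _) (hfin _)]
    congr! 2
    ext e
    by_cases he : e ∈ E(G)
    · obtain ⟨x, y, hxy⟩ := exists_isLink_of_mem_edgeSet he
      have hne := hxy.ne_of_loopless hl
      have hinc : G.Inc e a ↔ a = x ∨ a = y :=
        ⟨fun h => h.eq_or_eq_of_isLink hxy, by
          rintro (rfl | rfl); exacts [hxy.inc_left, hxy.inc_right]⟩
      simp only [Set.mem_symmDiff, Set.mem_ofPred_eq, Set.mem_inter_iff, hinc, mem_edgeCut_iff hxy,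
        Finset.coe_insert, Set.mem_insert_iff, Finset.mem_coe]
      by_cases h1 : a = x
      · subst h1
        have : y ≠ a := hne.symm
        tauto
      · by_cases h2 : a = y
        · subst h2
          tauto
        · have h1' := Ne.symm h1
          have h2' := Ne.symm h2
          tauto
    · have h1 : ∀ S, e ∉ G.edgeCut S := by
        rintro S ⟨p, hp, q, hq, h⟩
        exact he h.edge_mem
      have h2 : ¬ G.Inc e a := fun h => he h.edge_mem
      simp [Set.mem_symmDiff, h1, h2]

lemma even_ncard_inter_edgeCut (hG : G.IsFinite) (hl : G.Loopless) {Z : Set β} {X : Set α}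
    (hX : X ⊆ V(G)) (h : ∀ x ∈ X, Even (G.edgeDegree Z x)) : Even (Z ∩ G.edgeCut X).ncard := by
  lift X to Finset α using hG.1.subset hX
  rw [← even_sum_edgeDegree_iff hG hl]
  exact Finset.even_sum _ fun x hx => h x hx

lemma edgeCut_subset_edgeSet (G : Graph α β) (X : Set α) : G.edgeCut X ⊆ E(G) := by
  rintro e ⟨p, -, q, -, h⟩
  exact h.edge_mem

/-- An edge set that has odd degree exactly at the ends of a walk. -/
lemma exists_odd_edgeDegree_iff_of_reflTransGen (hG : G.IsFinite) (hl : G.Loopless) {Z : Set β}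
    {x y : α} (h : Relation.ReflTransGen (G.restrict Z).Adj x y) :
    ∃ A ⊆ Z, ∀ z, Odd (G.edgeDegree A z) ↔ ¬ (z = x ↔ z = y) := by
  classical
  induction h with
  | refl => exact ⟨∅, Set.empty_subset _, fun z => by simp [edgeDegree]⟩
  | tail hab hbc ih =>
    rename_i b c
    obtain ⟨A, hAZ, hA⟩ := ih
    obtain ⟨e, heZ, he⟩ := hbc
    -- The walk may repeat edges, so edges are added modulo 2.
    refine ⟨A ∆ {e}, ?_, fun z => ?_⟩
    · intro f hf
      rw [Set.mem_symmDiff] at hf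
      rcases hf with hf | hf
      · exact hAZ hf.1
      · rw [Set.mem_singleton_iff.1 hf.1]
        exact heZ
    · have hdeg : Even (G.edgeDegree {e} z) ↔ ¬ (z = b ∨ z = c) := by
        by_cases hz : z = b ∨ z = c
        · have : {f | f ∈ ({e} : Set β) ∧ G.Inc f z} = {e} := by
            ext f
            simp only [Set.mem_singleton_iff, Set.mem_ofPred_eq, and_iff_left_iff_imp]
            rintro rfl
            rcases hz with rfl | rfl
            exacts [he.inc_left, he.inc_right]
          rw [edgeDegree, this]
          simp [hz]
        · have : {f | f ∈ ({e} : Set β) ∧ G.Inc f z} = ∅ := by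
            ext f
            simp only [Set.mem_singleton_iff, Set.mem_ofPred_eq, Set.mem_empty_iff_false, iff_false]
            rintro ⟨rfl, hf⟩
            exact hz (hf.eq_or_eq_of_isLink he)
          rw [edgeDegree, this]
          simp [hz]
      have hne := he.ne_of_loopless hl
      have := hA z
      rw [← Nat.not_even_iff_odd] at this
      rw [← Nat.not_even_iff_odd, even_edgeDegree_symmDiff hG, hdeg]
      by_cases h1 : z = b
      · subst h1; tauto
      · tauto

/-- A finite set `T` that meets every class of `j` in an even number of vertices, any two of which
are joined by a walk in `Z`, is the set of odd vertices of some subset of `Z`. -/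
lemma exists_odd_edgeDegree_iff_mem (hG : G.IsFinite) (hl : G.Loopless) {ι : Type*} (j : α → ι)
    (Z : Set β) (T : Finset α)
    (hconn : ∀ x ∈ T, ∀ y ∈ T, j x = j y → Relation.ReflTransGen (G.restrict Z).Adj x y)
    (heven : ∀ k, Even {x | x ∈ T ∧ j x = k}.ncard) :
    ∃ A ⊆ Z, ∀ z, Odd (G.edgeDegree A z) ↔ z ∈ T := by
  classical
  induction hn : T.card using Nat.strong_induction_on generalizing T with
  | _ n ih =>
    subst hn
    obtain rfl | ⟨x, hx⟩ := T.eq_empty_or_nonempty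
    · exact ⟨∅, Set.empty_subset _, fun z => by simp [edgeDegree]⟩
    -- The class of `x` is even, so it contains a second element `y` of `T`. Join these two by a
    -- walk and treat the rest of `T` by induction; the two edge sets are added modulo 2.
    obtain ⟨y, hy, hyx, hjy⟩ : ∃ y ∈ T, y ≠ x ∧ j y = j x := by
      by_contra! hcon
      have : {y | y ∈ T ∧ j y = j x} = {x} := by
        ext y
        simp only [Set.mem_ofPred_eq, Set.mem_singleton_iff]
        constructor
        · rintro ⟨hy, hj⟩
          by_contra hne
          exact hcon y hy hne hj
        · rintro rfl; exact ⟨hx, rfl⟩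
      have h2 := heven (j x)
      rw [this] at h2
      simp at h2
    obtain ⟨A, hAZ, hA⟩ := exists_odd_edgeDegree_iff_of_reflTransGen hG hl
      (hconn x hx y hy hjy.symm)
    have hmem : ∀ z, z ∈ (T.erase x).erase y ↔ z ∈ T ∧ z ≠ x ∧ z ≠ y := by
      intro z; simp only [Finset.mem_erase]; tauto
    obtain ⟨B, hBZ, hB⟩ := ih ((T.erase x).erase y).card
      (Finset.card_lt_card ⟨fun z hz => ((hmem z).1 hz).1, fun h => by
        have := (hmem x).1 (h hx); tauto⟩) ((T.erase x).erase y)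
      (fun a ha b hb => hconn a ((hmem a).1 ha).1 b ((hmem b).1 hb).1) (by
        intro k
        have hfin : {z | z ∈ T ∧ j z = k}.Finite := T.finite_toSet.subset fun z hz => hz.1
        by_cases hk : j x = k
        · have h1 : {z | z ∈ (T.erase x).erase y ∧ j z = k} =
              {z | z ∈ T ∧ j z = k} ∆ ({x, y} : Set α) := by
            ext z
            simp only [hmem, Set.mem_symmDiff, Set.mem_ofPred_eq, Set.mem_insert_iff,
              Set.mem_singleton_iff]
            constructor
            · tauto
            · rintro (h | ⟨rfl | rfl, h⟩)
              · tauto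
              · exact absurd ⟨hx, hk⟩ h
              · exact absurd ⟨hy, hjy.trans hk⟩ h
          rw [h1, even_ncard_symmDiff hfin (Set.toFinite _), Set.ncard_pair hyx.symm]
          simpa using heven k
        · have h1 : {z | z ∈ (T.erase x).erase y ∧ j z = k} = {z | z ∈ T ∧ j z = k} := by
            ext z
            simp only [hmem, Set.mem_ofPred_eq]
            constructor
            · tauto
            · rintro ⟨hz, hjz⟩
              refine ⟨⟨hz, ?_, ?_⟩, hjz⟩
              · rintro rfl; exact hk hjz
              · rintro rfl; exact hk (hjy ▸ hjz)
          rw [h1]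
          exact heven k) rfl
    refine ⟨A ∆ B, ?_, fun z => ?_⟩
    · intro f hf
      rw [Set.mem_symmDiff] at hf
      rcases hf with hf | hf
      exacts [hAZ hf.1, hBZ hf.1]
    · have h1 := hA z
      have h2 := hB z
      rw [← Nat.not_even_iff_odd] at h1 h2 ⊢
      rw [even_edgeDegree_symmDiff hG]
      rw [hmem] at h2
      by_cases hzx : z = x
      · subst hzx; have := hyx.symm; tauto
      · by_cases hzy : z = y
        · subst hzy; tauto
        · tauto

/-! ### Components -/

/-- The component of `G` that contains `x`. -/
def componentAt (G : Graph α β) (x : α) : Graph α β :=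
  G.induce {y | y ∈ V(G) ∧ Relation.ReflTransGen G.Adj x y}

lemma reflTransGen_adj_symm {x y : α} (h : Relation.ReflTransGen G.Adj x y) :
    Relation.ReflTransGen G.Adj y x :=
  Std.Symm.symm _ _ h

lemma componentAt_le (G : Graph α β) (x : α) : G.componentAt x ≤ G :=
  induce_le fun _ hy => hy.1

lemma self_mem_componentAt {x : α} (hx : x ∈ V(G)) : x ∈ V(G.componentAt x) := ⟨hx, .refl⟩

lemma isLink_componentAt_iff {x y z : α} {e : β} (hy : y ∈ V(G.componentAt x)) :
    (G.componentAt x).IsLink e y z ↔ G.IsLink e y z := by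
  refine ⟨fun h => h.mono (componentAt_le G x), fun h => ⟨h, hy, h.right_mem, hy.2.tail ⟨e, h⟩⟩⟩

lemma inc_componentAt_iff {x y : α} {e : β} (hy : y ∈ V(G.componentAt x)) :
    (G.componentAt x).Inc e y ↔ G.Inc e y := by
  simp only [Inc, isLink_componentAt_iff hy]

lemma componentAt_eq {x y : α} (hy : y ∈ V(G.componentAt x)) :
    G.componentAt y = G.componentAt x := by
  unfold componentAt
  congr 1
  ext z
  exact and_congr_right fun _ => ⟨fun h => hy.2.trans h, fun h => (reflTransGen_adj_symm hy.2).trans h⟩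

lemma componentAt_eq_of_isLink {x y : α} {e : β} (h : G.IsLink e x y) :
    G.componentAt y = G.componentAt x :=
  componentAt_eq ⟨h.right_mem, .single ⟨e, h⟩⟩

lemma reflTransGen_componentAt {x y : α}
    (h : Relation.ReflTransGen G.Adj x y) :
    Relation.ReflTransGen (G.componentAt x).Adj x y := by
  induction h with
  | refl => exact .refl
  | tail hab hbc ih =>
    obtain ⟨e, he⟩ := hbc
    exact ih.tail ⟨e, (isLink_componentAt_iff ⟨he.left_mem, hab⟩).2 he⟩

lemma componentAt_isConnected {x : α} (hx : x ∈ V(G)) : (G.componentAt x).IsConnected := by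
  refine ⟨⟨x, self_mem_componentAt hx⟩, fun y hy z hz => ?_⟩
  exact (reflTransGen_adj_symm (reflTransGen_componentAt hy.2)).trans
    (reflTransGen_componentAt hz.2)

lemma reflTransGen_adj_mono (h : H ≤ G) {x y : α} (hxy : Relation.ReflTransGen H.Adj x y) :
    Relation.ReflTransGen G.Adj x y :=
  Relation.ReflTransGen.mono (show H.Adj ≤ G.Adj from fun _ _ hab => hab.mono h) x y hxy

lemma componentAt_isComponent {x : α} (hx : x ∈ V(G)) : (G.componentAt x).IsComponent G := by
  refine ⟨⟨componentAt_le G x, componentAt_isConnected hx⟩, fun H hH hle => ?_⟩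
  have hxH : x ∈ V(H) := hle.vertexSet_mono (self_mem_componentAt hx)
  have hV : ∀ y ∈ V(H), y ∈ V(G.componentAt x) := fun y hy =>
    ⟨hH.1.vertexSet_mono hy, reflTransGen_adj_mono hH.1 (hH.2.2 x hxH y hy)⟩
  exact ⟨hV, fun e y z hyz => ⟨hyz.mono hH.1, hV _ hyz.left_mem, hV _ hyz.right_mem⟩⟩

lemma degree_componentAt (hl : G.Loopless) {x y : α} (hy : y ∈ V(G.componentAt x)) :
    (G.componentAt x).degree y = (G.incidenceSet y).ncard := by
  rw [degree_eq_ncard_incidenceSet (loopless_of_le hl (componentAt_le G x))]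
  congr 1
  ext e
  exact inc_componentAt_iff hy

lemma isCycle_componentAt (hG : G.IsFinite) (hl : G.Loopless) {x : α} (hx : x ∈ V(G))
    (h : ∀ y ∈ V(G.componentAt x), (G.incidenceSet y).ncard = 2) :
    (G.componentAt x).IsCycle :=
  ⟨isFinite_of_le hG (componentAt_le G x), componentAt_isConnected hx, fun y hy => by
    rw [degree_componentAt hl hy, h y hy]⟩

lemma restrict_inc_iff {Z : Set β} {e : β} {x : α} :
    (G.restrict Z).Inc e x ↔ e ∈ Z ∧ G.Inc e x := by
  simp [Inc]

lemma ncard_incidenceSet_restrict (G : Graph α β) (Z : Set β) (x : α) :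
    ((G.restrict Z).incidenceSet x).ncard = G.edgeDegree Z x := by
  unfold edgeDegree
  congr 1
  ext e
  exact restrict_inc_iff

/-! ### Double covers by even edge sets -/

/-- `G` has a finite family of even edge sets that covers each edge precisely twice. -/
def HasEvenDoubleCover (G : Graph α β) : Prop :=
  ∃ (ι : Type) (_ : Finite ι) (Z : ι → Set β), (∀ i, Z i ⊆ E(G)) ∧
    (∀ i, ∀ x ∈ V(G), Even (G.edgeDegree (Z i) x)) ∧ ∀ e ∈ E(G), {i | e ∈ Z i}.ncard = 2

lemma IsCubic.ncard_incidenceSet (hG : G.IsCubic) {x : α} (hx : x ∈ V(G)) :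
    (G.incidenceSet x).ncard = 3 := by
  rw [← degree_eq_ncard_incidenceSet hG.2.1, hG.2.2 x hx]

lemma edgeDegree_le_of_isCubic (hG : G.IsCubic) (Z : Set β) {x : α} (hx : x ∈ V(G)) :
    G.edgeDegree Z x ≤ 3 := by
  rw [← hG.ncard_incidenceSet hx]
  exact Set.ncard_le_ncard (fun e he => he.2) (hG.1.2.subset (incidenceSet_subset_edgeSet x))

lemma edgeDegree_eq_two (hG : G.IsCubic) {Z : Set β} {x : α} (heven : Even (G.edgeDegree Z x))
    {e : β} (he : e ∈ Z) (hex : G.Inc e x) : G.edgeDegree Z x = 2 := by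
  have h1 := edgeDegree_le_of_isCubic hG Z hex.vertex_mem
  have h2 : 0 < G.edgeDegree Z x :=
    (Set.ncard_pos (finite_setOf_inc hG.1 Z x)).2 ⟨e, he, hex⟩
  obtain ⟨k, hk⟩ := heven
  omega

/-- The members of an even double cover of a cubic graph that contain a given edge have no common
component through this edge. -/
lemma componentAt_restrict_ne (hG : G.IsCubic) {ι : Type} [Finite ι] {Z : ι → Set β}
    (heven : ∀ i, ∀ x ∈ V(G), Even (G.edgeDegree (Z i) x))
    (hcov : ∀ e ∈ E(G), {i | e ∈ Z i}.ncard = 2) {a b : ι} (hab : a ≠ b) {e : β} {x : α}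
    (hex : G.Inc e x) (hea : e ∈ Z a) (heb : e ∈ Z b) :
    (G.restrict (Z a)).componentAt x ≠ (G.restrict (Z b)).componentAt x := by
  intro heq
  have hx := hex.vertex_mem
  have hincab : ∀ f, G.Inc f x → (f ∈ Z a ↔ f ∈ Z b) := by
    intro f hf
    have h1 : ∀ i, ((G.restrict (Z i)).componentAt x).Inc f x ↔ f ∈ Z i := fun i => by
      rw [inc_componentAt_iff (self_mem_componentAt (G := G.restrict (Z i)) hx), restrict_inc_iff]
      exact and_iff_left hf
    rw [← h1 a, ← h1 b, heq]
  have hda := edgeDegree_eq_two hG (heven a x hx) hea hex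
  obtain ⟨h, hh, hha⟩ : ∃ h, G.Inc h x ∧ h ∉ Z a := by
    by_contra! hcon
    have : {f | f ∈ Z a ∧ G.Inc f x} = G.incidenceSet x := by
      ext f; exact ⟨fun hf => hf.2, fun hf => ⟨hcon f hf, hf⟩⟩
    rw [edgeDegree, this, hG.ncard_incidenceSet hx] at hda
    omega
  -- Members `a` and `b` use the same two edges at `x`, and these are thereby covered. A member `k`
  -- through the third edge `h` would need one of them as its second edge at `x`.
  have hset : ∀ f, G.Inc f x → f ∈ Z a → {i | f ∈ Z i} = {a, b} := by
    intro f hf hfa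
    symm
    apply Set.eq_of_subset_of_ncard_le
    · rintro i (rfl | rfl)
      exacts [hfa, (hincab f hf).1 hfa]
    · rw [hcov f hf.edge_mem, Set.ncard_pair hab]
    · exact Set.toFinite _
  obtain ⟨k, hk⟩ : {i | h ∈ Z i}.Nonempty := by
    rw [← Set.ncard_pos (Set.toFinite _), hcov h hh.edge_mem]
    omega
  have hdk := edgeDegree_eq_two hG (heven k x hx) hk hh
  have hka : k ≠ a := by rintro rfl; exact hha hk
  have hkb : k ≠ b := by rintro rfl; exact hha ((hincab h hh).2 hk)
  have hsub : {f | f ∈ Z k ∧ G.Inc f x} ⊆ {h} := by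
    rintro f ⟨hfk, hf⟩
    by_cases hfa : f ∈ Z a
    · have : k ∈ {i | f ∈ Z i} := hfk
      rw [hset f hf hfa] at this
      rcases this with h | h
      exacts [absurd h hka, absurd h hkb]
    · by_contra hne
      have h3 : ({f, h} : Set β) ∪ {f | f ∈ Z a ∧ G.Inc f x} ⊆ G.incidenceSet x := by
        rintro g ((rfl | rfl) | hg)
        exacts [hf, hh, hg.2]
      have h4 := Set.ncard_le_ncard h3 (hG.1.2.subset (incidenceSet_subset_edgeSet x))
      rw [Set.ncard_union_eq ?_ (Set.toFinite _) (finite_setOf_inc hG.1 _ _), Set.ncard_pair hne,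
        hG.ncard_incidenceSet hx] at h4
      · unfold edgeDegree at hda; omega
      · rw [Set.disjoint_left]
        rintro g (rfl | rfl) hg
        exacts [hfa hg.1, hha hg.1]
  have h5 := Set.ncard_le_ncard hsub
  rw [Set.ncard_singleton] at h5
  unfold edgeDegree at hdk
  omega

/-- A member of the family has degree 2 wherever it has an edge, so its components with edges are
cycles. The cycles through `e` correspond to the members containing `e`, injectively by
`componentAt_restrict_ne`. -/
theorem HasEvenDoubleCover.exists_isCycleDoubleCover (hG : G.IsCubic)
    (h : G.HasEvenDoubleCover) : ∃ S : Set (Graph α β), G.IsCycleDoubleCover S := by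
  obtain ⟨ι, _, Z, hZ, heven, hcov⟩ := h
  refine ⟨{C | ∃ i e x, e ∈ Z i ∧ G.Inc e x ∧ C = (G.restrict (Z i)).componentAt x}, ?_, ?_⟩
  · rintro C ⟨i, e, x, he, hex, rfl⟩
    refine ⟨(componentAt_le _ _).trans restrict_le, ?_⟩
    refine isCycle_componentAt (isFinite_of_le hG.1 restrict_le)
      (loopless_of_le hG.2.1 restrict_le) hex.vertex_mem fun y hy => ?_
    rw [ncard_incidenceSet_restrict]
    obtain rfl | ⟨z, -, f, hfZ, hf⟩ := hy.2.cases_tail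
    · exact edgeDegree_eq_two hG (heven i _ hy.1) he hex
    · exact edgeDegree_eq_two hG (heven i _ hy.1) hfZ hf.inc_right
  · intro e he
    obtain ⟨x, y, hxy⟩ := exists_isLink_of_mem_edgeSet he
    have hset : {C | C ∈ {C | ∃ i e x, e ∈ Z i ∧ G.Inc e x ∧
          C = (G.restrict (Z i)).componentAt x} ∧ e ∈ E(C)} =
        (fun i => (G.restrict (Z i)).componentAt x) '' {i | e ∈ Z i} := by
      ext C
      constructor
      · rintro ⟨⟨i, f, z, hf, hfz, rfl⟩, heC⟩
        have heZ : e ∈ Z i := ((componentAt_le _ _).edgeSet_mono heC).2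
        refine ⟨i, heZ, componentAt_eq ?_⟩
        obtain ⟨p, q, hpq⟩ := exists_isLink_of_mem_edgeSet heC
        have := hpq.mono ((componentAt_le _ _).trans restrict_le)
        obtain ⟨rfl, rfl⟩ | ⟨rfl, rfl⟩ := hxy.eq_and_eq_or_eq_and_eq this
        exacts [hpq.left_mem, hpq.right_mem]
      · rintro ⟨i, hi, rfl⟩
        refine ⟨⟨i, e, x, hi, hxy.inc_left, rfl⟩, ?_⟩
        exact ((isLink_componentAt_iff (G := G.restrict (Z i))
          (self_mem_componentAt hxy.left_mem)).2 (show _ ∧ _ from ⟨hi, hxy⟩)).edge_mem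
    rw [hset, Set.InjOn.ncard_image, hcov e he]
    intro a ha b hb hab
    by_contra hne
    exact componentAt_restrict_ne hG heven hcov hne hxy.inc_left ha hb hab

/-! ### Colorings of the components of a Kotzig-frame -/

/-- An edge coloring of a graph with degrees 2 and 3 that is constant at the vertices of degree 2,
proper at the vertices of degree 3 and such that, for every color, the edges of the other two colors
lie in one component of the graph that they form. -/
def IsFrameColoring (L : Graph α β) (c : β → Fin 3) : Prop :=
  (∀ x ∈ V(L),
    ((L.incidenceSet x).ncard = 2 ∧ ∀ e f, L.Inc e x → L.Inc f x → c e = c f) ∨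
    ((L.incidenceSet x).ncard = 3 ∧ ∀ e f, L.Inc e x → L.Inc f x → e ≠ f → c e ≠ c f)) ∧
  ∀ i x y e f, L.Inc e x → c e ≠ i → L.Inc f y → c f ≠ i →
    Relation.ReflTransGen (L.restrict {e | c e ≠ i}).Adj x y

/-- With a single color, the graph of the other two colors is either the whole cycle or has no
edges, and then the connectivity clause is vacuous. -/
lemma IsCycle.isFrameColoring {L : Graph α β} (hl : L.Loopless) (hL : L.IsCycle) :
    L.IsFrameColoring fun _ => 0 := by
  refine ⟨fun x hx => Or.inl ⟨?_, fun _ _ _ _ => rfl⟩, fun i x y e f hex hi hfy _ => ?_⟩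
  · rw [← degree_eq_ncard_incidenceSet hl, hL.2.2 x hx]
  · refine reflTransGen_adj_mono ?_ (hL.2.1.2 x hex.vertex_mem y hfy.vertex_mem)
    exact ⟨le_rfl, fun a b d h => ⟨hi, h⟩⟩

lemma image_incidenceSet_eq_univ {L : Graph α β} {c : β → Fin 3} {x : α}
    (h3 : (L.incidenceSet x).ncard = 3)
    (hc : ∀ e f, L.Inc e x → L.Inc f x → e ≠ f → c e ≠ c f) :
    c '' L.incidenceSet x = Set.univ := by
  apply Set.eq_of_subset_of_ncard_le (Set.subset_univ _)
  rw [Set.InjOn.ncard_image, h3, Set.ncard_univ, Nat.card_eq_fintype_card, Fintype.card_fin]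
  intro e he f hf hef
  by_contra hne
  exact hc e f he hf hne hef

lemma edgeDegree_ne_color {L : Graph α β} {c : β → Fin 3} {x : α}
    (h3 : (L.incidenceSet x).ncard = 3)
    (hc : ∀ e f, L.Inc e x → L.Inc f x → e ≠ f → c e ≠ c f) (i : Fin 3) :
    L.edgeDegree {e | c e ≠ i} x = 2 := by
  have himg := image_incidenceSet_eq_univ h3 hc
  have h1 : c '' {e | e ∈ {e | c e ≠ i} ∧ L.Inc e x} = {i}ᶜ := by
    ext k
    constructor
    · rintro ⟨e, he, rfl⟩
      exact he.1
    · intro hk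
      obtain ⟨e, he, rfl⟩ : k ∈ c '' L.incidenceSet x := himg ▸ Set.mem_univ k
      exact ⟨e, ⟨hk, he⟩, rfl⟩
  rw [edgeDegree, ← Set.InjOn.ncard_image (f := c), h1]
  · rw [Set.ncard_compl, Set.ncard_singleton, Nat.card_eq_fintype_card, Fintype.card_fin]
  · intro e he f hf hef
    by_contra hne
    exact hc e f he.2 hf.2 hne hef

/-- Two color classes form a 2-regular graph; its component at `x` is a cycle with two colors, hence
hamiltonian. -/
lemma IsKotzigColoring.reflTransGen {K : Graph α β} (hK : K.IsCubic) {c : β → Fin 3}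
    (hc : K.IsKotzigColoring c) (i : Fin 3) {x y : α} (hx : x ∈ V(K)) (hy : y ∈ V(K)) :
    Relation.ReflTransGen (K.restrict {e | c e ≠ i}).Adj x y := by
  have hcyc : ((K.restrict {e | c e ≠ i}).componentAt x).IsCycle := by
    refine isCycle_componentAt (isFinite_of_le hK.1 restrict_le)
      (loopless_of_le hK.2.1 restrict_le) hx fun z hz => ?_
    rw [ncard_incidenceSet_restrict]
    exact edgeDegree_ne_color (hK.ncard_incidenceSet hz.1) (hc.1 z) i
  have hV := hc.2 _ ((componentAt_le _ _).trans restrict_le) hcyc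
    ⟨i + 1, i + 2, fun e he =>
      (by decide : ∀ i k : Fin 3, k ≠ i → k = i + 1 ∨ k = i + 2) i (c e)
        ((componentAt_le _ _).edgeSet_mono he).2⟩
  have : y ∈ V((K.restrict {e | c e ≠ i}).componentAt x) := hV ▸ hy
  exact this.2

/-- Each path inherits the color of the edge that it replaces. At a vertex of `K` the paths have
degree 1, so the colors there are those in `K`; any other vertex is interior to a single path. -/
lemma IsSubdivision.exists_isFrameColoring {L K : Graph α β} (hl : L.Loopless) (hK : K.IsKotzig)
    (h : L.IsSubdivision K) : ∃ c, L.IsFrameColoring c := by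
  classical
  obtain ⟨hcub, c, hc⟩ := hK
  obtain ⟨P, hP, hdis, hV, hE, -⟩ := h
  have hPle : ∀ e ∈ E(K), P e ≤ L := fun e he => by
    obtain ⟨x, y, hxy⟩ := exists_isLink_of_mem_edgeSet he
    exact (hP e x y hxy).1
  obtain ⟨c', hc'⟩ : ∃ c' : β → Fin 3, ∀ e ∈ E(K), ∀ f ∈ E(P e), c' f = c e := by
    refine ⟨fun f => if h : ∃ e ∈ E(K), f ∈ E(P e) then c h.choose else 0, fun e he f hf => ?_⟩
    have hex : ∃ e ∈ E(K), f ∈ E(P e) := ⟨e, he, hf⟩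
    simp only [dif_pos hex]
    congr 1
    by_contra hne
    exact Set.disjoint_left.1 (hdis _ hex.choose_spec.1 e he hne).2 hex.choose_spec.2 hf
  have hedge : ∀ f x, L.Inc f x → ∃ e ∈ E(K), (P e).Inc f x := by
    intro f x hfx
    have : f ∈ E(L) := hfx.edge_mem
    rw [hE] at this
    simp only [Set.mem_iUnion] at this
    obtain ⟨e, he, hf⟩ := this
    exact ⟨e, he, ((hPle e he).inc_congr hf).2 hfx⟩
  have hKinc : ∀ e ∈ E(K), ∀ x ∈ V(P e), x ∈ V(K) → K.Inc e x := by
    intro e he x hx hxK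
    obtain ⟨p, q, hpq⟩ := exists_isLink_of_mem_edgeSet he
    have : x ∈ V(P e) ∩ V(K) := ⟨hx, hxK⟩
    rw [(hP e p q hpq).2.2] at this
    rcases this with rfl | rfl
    exacts [hpq.inc_left, hpq.inc_right]
  have hPdeg : ∀ e ∈ E(K), ∀ x, (P e).degree x = ((P e).incidenceSet x).ncard := fun e he x =>
    degree_eq_ncard_incidenceSet (loopless_of_le hl (hPle e he)) x
  have hone : ∀ e x, K.Inc e x → ((P e).incidenceSet x).ncard = 1 := by
    rintro e x ⟨y, hxy⟩
    rw [← hPdeg e hxy.edge_mem]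
    exact (hP e x y hxy).2.1.2.2.2.2.2.1
  have hPc : ∀ i, ∀ e ∈ E(K), c e ≠ i → P e ≤ L.restrict {e | c' e ≠ i} := by
    intro i e he hi
    refine ⟨(hPle e he).vertexSet_mono, fun f a b hf => ⟨?_, hf.mono (hPle e he)⟩⟩
    show c' f ≠ i
    rwa [hc' e he f hf.edge_mem]
  have hPconn : ∀ i, ∀ e ∈ E(K), c e ≠ i → ∀ x ∈ V(P e), ∀ y ∈ V(P e),
      Relation.ReflTransGen (L.restrict {e | c' e ≠ i}).Adj x y := by
    intro i e he hi x hx y hy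
    obtain ⟨p, q, hpq⟩ := exists_isLink_of_mem_edgeSet he
    exact reflTransGen_adj_mono (hPc i e he hi) ((hP e p q hpq).2.1.2.1.2 x hx y hy)
  refine ⟨c', fun x hx => ?_, ?_⟩
  · by_cases hxK : x ∈ V(K)
    · right
      have hprop : ∀ f g, L.Inc f x → L.Inc g x → f ≠ g → c' f ≠ c' g := by
        intro f g hf hg hfg
        obtain ⟨e, he, hef⟩ := hedge f x hf
        obtain ⟨e', he', heg⟩ := hedge g x hg
        rw [hc' e he f hef.edge_mem, hc' e' he' g heg.edge_mem]
        refine hc.1 x e e' (hKinc e he x hef.vertex_mem hxK)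
          (hKinc e' he' x heg.vertex_mem hxK) ?_
        rintro rfl
        obtain ⟨d, hd⟩ := Set.ncard_eq_one.1 (hone e x (hKinc e he x hef.vertex_mem hxK))
        have h1 : f ∈ (P e).incidenceSet x := hef
        have h2 : g ∈ (P e).incidenceSet x := heg
        rw [hd] at h1 h2
        exact hfg (h1.trans h2.symm)
      refine ⟨?_, hprop⟩
      have himg : c' '' L.incidenceSet x = Set.univ := by
        rw [Set.eq_univ_iff_forall]
        intro k
        have : k ∈ c '' K.incidenceSet x :=
          image_incidenceSet_eq_univ (hcub.ncard_incidenceSet hxK) (hc.1 x) ▸ Set.mem_univ k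
        obtain ⟨e, he, rfl⟩ := this
        obtain ⟨d, hd⟩ := Set.ncard_eq_one.1 (hone e x he)
        have h1 : (P e).Inc d x := by
          have : d ∈ (P e).incidenceSet x := hd ▸ rfl
          exact this
        exact ⟨d, h1.mono (hPle e he.edge_mem), hc' e he.edge_mem d h1.edge_mem⟩
      rw [← Set.InjOn.ncard_image (f := c'), himg, Set.ncard_univ, Nat.card_eq_fintype_card,
        Fintype.card_fin]
      intro f hf g hg hfg
      by_contra hne
      exact hprop f g hf hg hne hfg
    · left
      have : x ∈ V(L) := hx
      rw [hV] at this
      simp only [Set.mem_union, hxK, Set.mem_iUnion, false_or] at this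
      obtain ⟨e, he, hxe⟩ := this
      have huniq : ∀ f, L.Inc f x ↔ (P e).Inc f x := by
        refine fun f => ⟨fun hf => ?_, fun hf => hf.mono (hPle e he)⟩
        obtain ⟨e', he', hef⟩ := hedge f x hf
        by_cases hee : e = e'
        · rwa [hee]
        · exact absurd ((hdis e he e' he' hee).1 ⟨hxe, hef.vertex_mem⟩) hxK
      constructor
      · have : L.incidenceSet x = (P e).incidenceSet x := Set.ext huniq
        obtain ⟨p, q, hpq⟩ := exists_isLink_of_mem_edgeSet he
        rw [this, ← hPdeg e he]
        refine (hP e p q hpq).2.1.2.2.2.2.2.2.2 x hxe ?_ ?_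
        · rintro rfl; exact hxK hpq.left_mem
        · rintro rfl; exact hxK hpq.right_mem
      · intro f g hf hg
        rw [hc' e he f ((huniq f).1 hf).edge_mem, hc' e he g ((huniq g).1 hg).edge_mem]
  · intro i x y f g hf hfi hg hgi
    -- Run along a path to a vertex of `K`; there a two-colored walk of `K` can be followed with
    -- every edge replaced by its path.
    have hend : ∀ f x, L.Inc f x → c' f ≠ i → ∃ p ∈ V(K),
        Relation.ReflTransGen (L.restrict {e | c' e ≠ i}).Adj x p := by
      intro f x hf hfi
      obtain ⟨e, he, hef⟩ := hedge f x hf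
      rw [hc' e he f hef.edge_mem] at hfi
      obtain ⟨p, q, hpq⟩ := exists_isLink_of_mem_edgeSet he
      exact ⟨p, hpq.left_mem, hPconn i e he hfi x hef.vertex_mem p
        (hP e p q hpq).2.1.2.2.2.1⟩
    obtain ⟨p, hp, hxp⟩ := hend f x hf hfi
    obtain ⟨q, hq, hyq⟩ := hend g y hg hgi
    refine hxp.trans (Relation.ReflTransGen.trans ?_ (reflTransGen_adj_symm hyq))
    have hpq := hc.reflTransGen hcub i hp hq
    clear hxp hyq hq
    induction hpq with
    | refl => exact .refl
    | tail _ hab ih =>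
      obtain ⟨e, hei, he⟩ := hab
      exact ih.trans (hPconn i e he.edge_mem hei _ (hP e _ _ he).2.1.2.2.2.1 _
        (hP e _ _ he).2.1.2.2.2.2.1)

/-! ### Even double covers from Kotzig-frames -/

lemma edgeDegree_inter_edgeSet (hFG : F ≤ G) (Z : Set β) (x : α) :
    G.edgeDegree (E(F) ∩ Z) x = F.edgeDegree Z x := by
  unfold edgeDegree
  congr 1
  ext e
  constructor
  · rintro ⟨⟨h1, h2⟩, h3⟩
    exact ⟨h2, (hFG.inc_congr h1).2 h3⟩
  · rintro ⟨h1, h2⟩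
    exact ⟨⟨h2.edge_mem, h1⟩, h2.mono hFG⟩

/-- In a cubic graph, a vertex of degree at least 2 in a subgraph is incident with at most one
further edge, and with none if the degree is 3. -/
lemma inc_unique_of_notMem (hG : G.IsCubic) (hFG : F ≤ G) {x : α}
    (h2 : 2 ≤ (F.incidenceSet x).ncard) {m m' : β} (hm : m ∉ E(F)) (hmx : G.Inc m x)
    (hm' : m' ∉ E(F)) (hmx' : G.Inc m' x) : m = m' ∧ (F.incidenceSet x).ncard = 2 := by
  have hfin : (G.incidenceSet x).Finite := hG.1.2.subset (incidenceSet_subset_edgeSet x)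
  have hsub : F.incidenceSet x ⊆ G.incidenceSet x := fun e he => Inc.mono hFG he
  have h3 := hG.ncard_incidenceSet hmx.vertex_mem
  have h4 : ({m, m'} : Set β) ∪ F.incidenceSet x ⊆ G.incidenceSet x := by
    rintro g ((rfl | rfl) | hg)
    exacts [hmx, hmx', hsub hg]
  have h5 := Set.ncard_le_ncard h4 hfin
  rw [Set.ncard_union_eq ?_ (Set.toFinite _) (hfin.subset hsub), h3] at h5
  · by_cases h : m = m'
    · subst h
      simp at h5
      exact ⟨rfl, by omega⟩
    · rw [Set.ncard_pair h] at h5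
      omega
  · rw [Set.disjoint_left]
    rintro g (rfl | rfl) hg
    exacts [hm (Inc.edge_mem hg), hm' (Inc.edge_mem hg)]

/-- Let the edges of a spanning subgraph `F` of a cubic graph `G` be colored by `c` and the other
edges by `g`. If `c` is constant at the vertices of degree 2 in `F` and proper at those of degree 3,
and `g` is compatible with `c` and meets each component of `F` evenly in each color, then `G` has a
double cover by six even edge sets. -/
lemma hasEvenDoubleCover_of_colorings (hG : G.IsCubic) (hFG : F ≤ G) {ι : Type*} (j : α → ι)
    (c g : β → Fin 3)
    (hdeg : ∀ x ∈ V(G), ((F.incidenceSet x).ncard = 2 ∧ ∃ k, (∀ e, F.Inc e x → c e = k) ∧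
        ∀ m ∉ E(F), G.Inc m x → g m ≠ k) ∨
      ((F.incidenceSet x).ncard = 3 ∧ ∀ e f, F.Inc e x → F.Inc f x → e ≠ f → c e ≠ c f))
    (hconn : ∀ i x y e f, j x = j y → F.Inc e x → c e ≠ i → F.Inc f y → c f ≠ i →
      Relation.ReflTransGen (F.restrict {e | c e ≠ i}).Adj x y)
    (heven : ∀ i k, Even {x | (∃ m ∉ E(F), G.Inc m x ∧ g m = i) ∧ j x = k}.ncard) :
    G.HasEvenDoubleCover := by
  classical
  have hdeg2 : ∀ x ∈ V(G), 2 ≤ (F.incidenceSet x).ncard := fun x hx => by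
    rcases hdeg x hx with h | h <;> omega
  -- A vertex meets at most one edge outside `F`, so these degrees are 0 or 1.
  have hdegM : ∀ i x, Odd (G.edgeDegree {m | m ∈ E(G) ∧ m ∉ E(F) ∧ g m = i} x) ↔
      ∃ m ∉ E(F), G.Inc m x ∧ g m = i := by
    intro i x
    by_cases h : ∃ m ∉ E(F), G.Inc m x ∧ g m = i
    · obtain ⟨m, hm, hmx, hgm⟩ := h
      have : {e | e ∈ {m | m ∈ E(G) ∧ m ∉ E(F) ∧ g m = i} ∧ G.Inc e x} = {m} := by
        ext e
        constructor
        · rintro ⟨⟨-, he, -⟩, hex⟩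
          exact (inc_unique_of_notMem hG hFG (hdeg2 x hmx.vertex_mem) he hex hm hmx).1
        · rintro rfl
          exact ⟨⟨hmx.edge_mem, hm, hgm⟩, hmx⟩
      rw [edgeDegree, this, Set.ncard_singleton]
      exact iff_of_true odd_one ⟨m, hm, hmx, hgm⟩
    · have : {e | e ∈ {m | m ∈ E(G) ∧ m ∉ E(F) ∧ g m = i} ∧ G.Inc e x} = ∅ := by
        rw [Set.eq_empty_iff_forall_notMem]
        rintro e ⟨⟨-, he, hgi⟩, hex⟩
        exact h ⟨e, he, hex, hgi⟩
      rw [edgeDegree, this, Set.ncard_empty]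
      exact iff_of_false (by decide) h
  have hdegH : ∀ i, ∀ x ∈ V(G), Even (G.edgeDegree (E(F) ∩ {e | c e ≠ i}) x) := by
    intro i x hx
    rw [edgeDegree_inter_edgeSet hFG]
    rcases hdeg x hx with ⟨h2, k, hk, -⟩ | ⟨h3, hprop⟩
    · by_cases hki : k = i
      · have : {e | e ∈ {e | c e ≠ i} ∧ F.Inc e x} = ∅ := by
          rw [Set.eq_empty_iff_forall_notMem]
          rintro e ⟨he, hex⟩
          exact he ((hk e hex).trans hki)
        rw [edgeDegree, this, Set.ncard_empty]
        exact Even.zero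
      · have : {e | e ∈ {e | c e ≠ i} ∧ F.Inc e x} = F.incidenceSet x := by
          ext e
          refine ⟨fun h => h.2, fun h => ⟨?_, h⟩⟩
          show c e ≠ i
          rwa [hk e h]
        rw [edgeDegree, this, h2]
        exact even_two
    · rw [edgeDegree_ne_color h3 hprop]
      exact even_two
  have hA : ∀ i, ∃ A ⊆ E(F) ∩ {e | c e ≠ i}, ∀ x,
      Odd (G.edgeDegree A x) ↔ ∃ m ∉ E(F), G.Inc m x ∧ g m = i := by
    intro i
    have hTfin : {x | ∃ m ∉ E(F), G.Inc m x ∧ g m = i}.Finite :=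
      hG.1.1.subset fun x ⟨m, _, hm, _⟩ => hm.vertex_mem
    -- An end of a non-frame edge of color `i` has degree 2 in `F`, and compatibility makes its
    -- frame color different from `i`, so it lies on frame edges available for `A`.
    have hTF : ∀ x, (∃ m ∉ E(F), G.Inc m x ∧ g m = i) → ∃ e, F.Inc e x ∧ c e ≠ i := by
      rintro x ⟨m, hm, hmx, hgm⟩
      have h2 := (inc_unique_of_notMem hG hFG (hdeg2 x hmx.vertex_mem) hm hmx hm hmx).2
      rcases hdeg x hmx.vertex_mem with ⟨-, k, hk, hgk⟩ | ⟨h3, -⟩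
      · obtain ⟨e, he⟩ : (F.incidenceSet x).Nonempty :=
          Set.nonempty_of_ncard_ne_zero (by omega)
        refine ⟨e, he, ?_⟩
        rw [hk e he, ← hgm]
        exact (hgk m hm hmx).symm
      · omega
    obtain ⟨A, hAs, hAo⟩ := exists_odd_edgeDegree_iff_mem hG.1 hG.2.1 j (E(F) ∩ {e | c e ≠ i})
      hTfin.toFinset (by
        intro x hx y hy hxy
        rw [Set.Finite.mem_toFinset] at hx hy
        obtain ⟨e, he, hei⟩ := hTF x hx
        obtain ⟨f, hf, hfi⟩ := hTF y hy
        refine reflTransGen_adj_mono ?_ (hconn i x y e f hxy he hei hf hfi)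
        exact ⟨hFG.vertexSet_mono, fun e a b h => ⟨⟨h.2.edge_mem, h.1⟩, h.2.mono hFG⟩⟩)
      (by
        intro k
        simp only [Set.Finite.mem_toFinset]
        exact heven i k)
    refine ⟨A, hAs, fun x => ?_⟩
    rw [hAo, Set.Finite.mem_toFinset]
    rfl
  choose A hAs hAo using hA
  have hMA : ∀ i B, B ⊆ E(F) → Disjoint {m | m ∈ E(G) ∧ m ∉ E(F) ∧ g m = i} B :=
    fun i B hB => Set.disjoint_left.2 fun m hm hmB => hm.2.1 (hB hmB)
  have hAF : ∀ i, A i ⊆ E(F) := fun i e he => (hAs i he).1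
  have hHF : ∀ i, (E(F) ∩ {e | c e ≠ i}) \ A i ⊆ E(F) := fun i e he => he.1.1
  -- The Boolean selects `A` or its complement among the frame edges of color other than `i`. Both
  -- have the same degree parities, since these frame edges form an even set.
  refine ⟨Fin 3 × Bool, inferInstance, fun p => {m | m ∈ E(G) ∧ m ∉ E(F) ∧ g m = p.1} ∪
    (if p.2 then A p.1 else (E(F) ∩ {e | c e ≠ p.1}) \ A p.1), ?_, ?_, ?_⟩
  · rintro ⟨i, b⟩
    refine Set.union_subset (fun m hm => hm.1) ?_
    cases b
    · simpa using (hHF i).trans hFG.edgeSet_mono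
    · simpa using (hAF i).trans hFG.edgeSet_mono
  · rintro ⟨i, b⟩ x hx
    have h1 := hdegM i x
    have h2 := hAo i x
    cases b
    · simp only [Bool.false_eq_true, if_false]
      rw [edgeDegree_union hG.1 (hMA i _ (hHF i))]
      have h3 := hdegH i x hx
      rw [← Set.union_sdiff_cancel (hAs i), edgeDegree_union hG.1 disjoint_sdiff_self_right] at h3
      rw [Nat.even_add, ← Nat.not_odd_iff_even, ← Nat.not_odd_iff_even] at h3 ⊢
      exact (not_congr (h1.trans h2.symm)).trans h3
    · simp only [if_true]
      rw [edgeDegree_union hG.1 (hMA i _ (hAF i)), Nat.even_add, ← Nat.not_odd_iff_even,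
        ← Nat.not_odd_iff_even]
      exact not_congr (h1.trans h2.symm)
  · intro e he
    by_cases heF : e ∈ E(F)
    -- A frame edge is available for the two colors other than its own, and for each of these lies
    -- in exactly one of `A` and its complement.
    · have key : ∀ i k : Fin 3, k ≠ i ↔ i = k + 1 ∨ i = k + 2 := by decide
      have : {p : Fin 3 × Bool | e ∈ {m | m ∈ E(G) ∧ m ∉ E(F) ∧ g m = p.1} ∪
          (if p.2 then A p.1 else (E(F) ∩ {e | c e ≠ p.1}) \ A p.1)} =
          {(c e + 1, decide (e ∈ A (c e + 1))), (c e + 2, decide (e ∈ A (c e + 2)))} := by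
        ext ⟨i, b⟩
        have hAc : e ∈ A i → c e ≠ i := fun h => (hAs i h).2
        have : (i = c e + 1 ∨ i = c e + 2) → ((i, b) ∈
            ({(c e + 1, decide (e ∈ A (c e + 1))), (c e + 2, decide (e ∈ A (c e + 2)))} :
              Set (Fin 3 × Bool)) ↔ b = decide (e ∈ A i)) := by
          have h12 : c e + 1 ≠ c e + 2 := by generalize c e = k; revert k; decide
          rintro (rfl | rfl)
          · simp [h12]
          · simp [h12.symm]
        by_cases hi : c e ≠ i
        · rw [this ((key _ _).1 hi)]
          cases b <;> simp [heF, hi]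
        · have hnA : e ∉ A i := fun h => hi (hAc h)
          have hn := mt (key i (c e)).2 hi
          push Not at hn hi
          have : (i, b) ∉ ({(c e + 1, decide (e ∈ A (c e + 1))),
              (c e + 2, decide (e ∈ A (c e + 2)))} : Set (Fin 3 × Bool)) := by
            rintro (h | h)
            exacts [hn.1 (congrArg Prod.fst h), hn.2 (congrArg Prod.fst h)]
          refine iff_of_false ?_ this
          cases b <;> simp [heF, hi, hnA]
      rw [this, Set.ncard_pair]
      intro h
      have := congrArg Prod.fst h
      simp at this
    · have : {p : Fin 3 × Bool | e ∈ {m | m ∈ E(G) ∧ m ∉ E(F) ∧ g m = p.1} ∪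
          (if p.2 then A p.1 else (E(F) ∩ {e | c e ≠ p.1}) \ A p.1)} =
          {(g e, true), (g e, false)} := by
        ext ⟨i, b⟩
        have hnA : e ∉ A i := fun h => heF (hAF i h)
        cases b <;> simp only [Set.mem_ofPred_eq, Set.mem_union, he, heF, hnA, not_false_iff, true_and,
          Bool.false_eq_true, if_true, if_false, Set.mem_sdiff, Set.mem_inter_iff, false_and, or_false,
          Set.mem_insert_iff, Set.mem_singleton_iff, Prod.mk.injEq, and_true, and_false,
          reduceCtorEq, false_or] <;> exact eq_comm
      rw [this, Set.ncard_pair]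
      simp

lemma isLink_of_inc_of_inc {p q : α} {e : β} (hp : G.Inc e p) (hq : G.Inc e q) (h : p ≠ q) :
    G.IsLink e p q := by
  obtain ⟨p', hp'⟩ := hp
  obtain rfl := hq.eq_of_isLink_of_ne_left hp' h.symm
  exact hp'

/-- Nonemptiness supplies a value in `Fin s` for arguments outside `S`. -/
lemma exists_fin_injOn {γ : Type*} {S : Set γ} (hS : S.Finite) (hne : S.Nonempty) :
    ∃ (s : ℕ) (φ : γ → Fin s), Set.InjOn φ S := by
  classical
  obtain ⟨a, ha⟩ := hne
  have := hS.to_subtype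
  obtain ⟨s, ⟨φ⟩⟩ := Finite.exists_equiv_fin S
  refine ⟨s, fun x => if h : x ∈ S then φ ⟨x, h⟩ else φ ⟨a, ha⟩, fun x hx y hy hxy => ?_⟩
  simp only [dif_pos hx, dif_pos hy] at hxy
  exact congrArg Subtype.val (φ.injective hxy)

/-- The components of a Kotzig-frame, numbered by `j`, and their colorings: `c` colors the edges of
the frame and `r x` is the color at a vertex `x` of degree 2. -/
lemma IsKotzigFrame.exists_coloring (hG : G.IsCubic) (hne : V(G).Nonempty)
    (hF : G.IsKotzigFrame F) :
    ∃ (s : ℕ) (j : α → Fin s) (c : β → Fin 3) (r : α → Fin 3),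
      (∀ e x y, F.IsLink e x y → j x = j y) ∧
      (∀ k, Even {x | x ∈ V(G) ∧ j x = k}.ncard) ∧
      (∀ x ∈ V(G), ((F.incidenceSet x).ncard = 2 ∧ ∀ e, F.Inc e x → c e = r x) ∨
        ((F.incidenceSet x).ncard = 3 ∧ ∀ e f, F.Inc e x → F.Inc f x → e ≠ f → c e ≠ c f)) ∧
      ∀ i x y e f, j x = j y → F.Inc e x → c e ≠ i → F.Inc f y → c f ≠ i →
        Relation.ReflTransGen
          (F.restrict {e | c e ≠ i ∧ ∃ z, F.Inc e z ∧ j z = j x}).Adj x y := by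
  classical
  obtain ⟨⟨hFG, hV⟩, hcomp⟩ := hF
  have hFl : F.Loopless := loopless_of_le hG.2.1 hFG
  obtain ⟨s, φ, hφ⟩ := exists_fin_injOn (S := F.componentAt '' V(G)) (hG.1.1.image _)
    (hne.image _)
  have hj : ∀ x ∈ V(G), ∀ y ∈ V(G), φ (F.componentAt x) = φ (F.componentAt y) →
      F.componentAt x = F.componentAt y := fun x hx y hy h =>
    hφ (Set.mem_image_of_mem _ hx) (Set.mem_image_of_mem _ hy) h
  -- The hypothesis on `L` stands inside the existential so that a coloring can be chosen for every
  -- graph at once.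
  have hcol : ∀ L : Graph α β, ∃ c, L.IsComponent F → L.IsFrameColoring c := by
    intro L
    by_cases hL : L.IsComponent F
    · have hLl : L.Loopless := loopless_of_le hFl hL.1.1
      rcases (hcomp L hL).2 with h | ⟨K, hK, hsub⟩
      · exact ⟨_, fun _ => h.isFrameColoring hLl⟩
      · obtain ⟨c, hc⟩ := hsub.exists_isFrameColoring hLl hK
        exact ⟨c, fun _ => hc⟩
    · exact ⟨fun _ => 0, fun h => absurd h hL⟩
  choose col hcol using hcol
  have hlink : ∀ e x y, F.IsLink e x y → F.componentAt x = F.componentAt y := fun e x y h =>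
    (componentAt_eq_of_isLink h).symm
  obtain ⟨c, hc⟩ : ∃ c : β → Fin 3, ∀ e x, F.Inc e x → c e = col (F.componentAt x) e := by
    refine ⟨fun e => if h : ∃ x, F.Inc e x then col (F.componentAt h.choose) e else 0,
      fun e x hx => ?_⟩
    have hex : ∃ x, F.Inc e x := ⟨x, hx⟩
    simp only [dif_pos hex]
    by_cases h : hex.choose = x
    · rw [h]
    · rw [hlink e _ _ (isLink_of_inc_of_inc hex.choose_spec hx h)]
  have hinc : ∀ x ∈ V(F), ∀ e, (F.componentAt x).Inc e x ↔ F.Inc e x := fun x hx e =>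
    inc_componentAt_iff (self_mem_componentAt hx)
  have hdeg : ∀ x ∈ V(G), ∃ k, ((F.incidenceSet x).ncard = 2 ∧ ∀ e, F.Inc e x → c e = k) ∨
        ((F.incidenceSet x).ncard = 3 ∧
          ∀ e f, F.Inc e x → F.Inc f x → e ≠ f → c e ≠ c f) := by
    intro x hx
    rw [← hV] at hx
    have hset : (F.componentAt x).incidenceSet x = F.incidenceSet x := Set.ext (hinc x hx)
    rcases (hcol _ (componentAt_isComponent hx)).1 x (self_mem_componentAt hx) with h | h
    · rw [hset] at h
      obtain ⟨e, he⟩ : (F.incidenceSet x).Nonempty := Set.nonempty_of_ncard_ne_zero (by omega)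
      refine ⟨c e, Or.inl ⟨h.1, fun f hf => ?_⟩⟩
      rw [hc f x hf, hc e x he]
      exact h.2 f e ((hinc x hx f).2 hf) ((hinc x hx e).2 he)
    · rw [hset] at h
      -- The row of a vertex of degree 3 in `F` is arbitrary: no edge outside `F` meets it.
      refine ⟨0, Or.inr ⟨h.1, fun e f he hf hef => ?_⟩⟩
      rw [hc e x he, hc f x hf]
      exact h.2 e f ((hinc x hx e).2 he) ((hinc x hx f).2 hf) hef
  choose! r hr using hdeg
  refine ⟨s, fun x => φ (F.componentAt x), c, r, fun e x y h => congrArg φ (hlink e x y h),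
    fun k => ?_, hr, ?_⟩
  · by_cases hk : ∃ x ∈ V(G), φ (F.componentAt x) = k
    · obtain ⟨x, hx, rfl⟩ := hk
      have : {y | y ∈ V(G) ∧ φ (F.componentAt y) = φ (F.componentAt x)} =
          V(F.componentAt x) := by
        ext y
        constructor
        · rintro ⟨hy, hyx⟩
          rw [← hj y hy x hx hyx]
          exact self_mem_componentAt (hV ▸ hy)
        · intro hy
          exact ⟨hV ▸ hy.1, congrArg φ (componentAt_eq hy)⟩
      rw [this]
      exact (hcomp _ (componentAt_isComponent (hV ▸ hx))).1
    · have : {y | y ∈ V(G) ∧ φ (F.componentAt y) = k} = ∅ :=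
        Set.eq_empty_iff_forall_notMem.2 fun y hy => hk ⟨y, hy.1, hy.2⟩
      rw [this, Set.ncard_empty]
      exact Even.zero
  · intro i x y e f hxy he hei hf hfi
    have hx := he.vertex_mem
    have hy := hf.vertex_mem
    have hLxy := hj x (hV ▸ hx) y (hV ▸ hy) hxy
    rw [hc e x he] at hei
    rw [hc f y hf, ← hLxy] at hfi
    have hfy := (hinc y hy f).2 hf
    rw [← hLxy] at hfy
    have h := (hcol _ (componentAt_isComponent hx)).2 i x y e f ((hinc x hx e).2 he) hei hfy hfi
    refine reflTransGen_adj_mono ?_ h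
    refine ⟨fun z hz => hz.1, fun d a b hd => ?_⟩
    obtain ⟨hdi, hd⟩ := hd
    have hda : F.IsLink d a b := hd.mono (componentAt_le F x)
    have hLa : F.componentAt a = F.componentAt x := componentAt_eq hd.left_mem
    -- The walk is recorded as staying in its own component, because the colors will later be
    -- permuted differently in different components.
    refine ⟨⟨?_, a, hda.inc_left, congrArg φ hLa⟩, hda⟩
    rw [hc d a hda.inc_left, hLa]
    exact hdi

/-- The 3-row graph of a frame: the component of `x` is the column `j x`, the color at `x` is its
row `r x`, and the edges are the edges outside the frame that join different components. -/
def frameRow {s : ℕ} (G F : Graph α β) (j : α → Fin s) (r : α → Fin 3) :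
    Graph (Fin 3 × Fin s) β where
  vertexSet := Set.univ
  IsLink e p q := ∃ x y, G.IsLink e x y ∧ e ∉ E(F) ∧ j x ≠ j y ∧ p = (r x, j x) ∧ q = (r y, j y)
  isLink_symm e _ := ⟨by
    rintro p q ⟨x, y, h, he, hj, hp, hq⟩
    exact ⟨y, x, h.symm, he, hj.symm, hq, hp⟩⟩
  eq_or_eq_of_isLink_of_isLink := by
    rintro e p q p' q' ⟨x, y, h, -, -, rfl, rfl⟩ ⟨x', y', h', -, -, rfl, rfl⟩
    obtain rfl | rfl := h.left_eq_or_eq h'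
    exacts [Or.inl rfl, Or.inr rfl]
  left_mem_of_isLink := by
    intros
    trivial

/-! ### The 3-row graph of a frame is eulerian on columns -/

section frameRow

variable {s : ℕ} {j : α → Fin s} {r : α → Fin 3}

lemma frameRow_inc_iff {e : β} {p : Fin 3 × Fin s} :
    (G.frameRow F j r).Inc e p ↔
      ∃ x y, G.IsLink e x y ∧ e ∉ E(F) ∧ j x ≠ j y ∧ p = (r x, j x) := by
  constructor
  · rintro ⟨q, x, y, h1, h2, h3, h4, -⟩
    exact ⟨x, y, h1, h2, h3, h4⟩
  · rintro ⟨x, y, h1, h2, h3, h4⟩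
    exact ⟨_, x, y, h1, h2, h3, h4, rfl⟩

lemma frameRow_isFinite (hG : G.IsFinite) : (G.frameRow F j r).IsFinite := by
  refine ⟨Set.toFinite _, hG.2.subset ?_⟩
  rintro e ⟨p, q, x, y, h, -⟩
  exact h.edge_mem

lemma frameRow_isThreeRow (hG : G.IsFinite) : (G.frameRow F j r).IsThreeRow := by
  refine ⟨rfl, (frameRow_isFinite hG).2, ?_⟩
  rintro i i' k ⟨e, x, y, -, -, h, h1, h2⟩
  exact h ((congrArg Prod.snd h1).symm.trans (congrArg Prod.snd h2))

lemma frameRow_loopless (hG : G.IsFinite) : (G.frameRow F j r).Loopless :=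
  ⟨fun e p h => (frameRow_isThreeRow hG).2.2 p.1 p.1 p.2 ⟨e, h⟩⟩

lemma edgeCut_column (hj : ∀ e x y, F.IsLink e x y → j x = j y) (hFG : F ≤ G) (k : Fin s) :
    G.edgeCut {x | x ∈ V(G) ∧ j x = k} =
      {e | ∃ x y, G.IsLink e x y ∧ e ∉ E(F) ∧ j x ≠ j y ∧ j x = k} := by
  ext e
  constructor
  · rintro ⟨x, ⟨hx, hxk⟩, y, hy, h⟩
    have hne : j x ≠ j y := fun h' => hy ⟨h.right_mem, h' ▸ hxk⟩
    exact ⟨x, y, h, fun he => hne (hj e x y ((hFG.isLink_iff he).2 h)), hne, hxk⟩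
  · rintro ⟨x, y, h, he, hne, hxk⟩
    exact ⟨x, ⟨h.left_mem, hxk⟩, y, fun hy => hne (hxk.trans hy.2.symm), h⟩

/-- The edges at a column are the edge cut of a component. By the handshake argument its size has
the parity of three times the order of that component, which is even. -/
lemma columnQuotient_frameRow_isEulerian (hG : G.IsCubic)
    (hj : ∀ e x y, F.IsLink e x y → j x = j y) (hFG : F ≤ G)
    (heven : ∀ k, Even {x | x ∈ V(G) ∧ j x = k}.ncard) :
    (G.frameRow F j r).columnQuotient.IsEulerian := by
  rintro k -
  have hinc : (G.frameRow F j r).columnQuotient.incidenceSet k =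
      G.edgeCut {x | x ∈ V(G) ∧ j x = k} := by
    rw [edgeCut_column hj hFG]
    ext e
    constructor
    · rintro ⟨-, p, q, ⟨x, y, h1, h2, h3, rfl, rfl⟩, rfl, rfl⟩
      exact ⟨x, y, h1, h2, h3, rfl⟩
    · rintro ⟨x, y, h1, h2, h3, rfl⟩
      exact ⟨j y, (r x, j x), (r y, j y), ⟨x, y, h1, h2, h3, rfl, rfl⟩, rfl, rfl⟩
  have hloop : (G.frameRow F j r).columnQuotient.loopSet k = ∅ := by
    rw [Set.eq_empty_iff_forall_notMem]
    rintro e ⟨p, q, ⟨x, y, h1, h2, h3, rfl, rfl⟩, rfl, h⟩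
    exact h3 h.symm
  rw [degree, hinc, hloop, Set.ncard_empty, add_zero]
  have hXfin : {x | x ∈ V(G) ∧ j x = k}.Finite := hG.1.1.subset fun x hx => hx.1
  have h := even_sum_edgeDegree_iff hG.1 hG.2.1 E(G) hXfin.toFinset
  rw [hXfin.coe_toFinset, Set.inter_eq_right.2 (edgeCut_subset_edgeSet G _)] at h
  rw [← h, Finset.sum_congr rfl (g := fun _ => 3) fun x hx => by
    rw [edgeDegree_edgeSet, hG.ncard_incidenceSet (hXfin.mem_toFinset.1 hx).1]]
  rw [Finset.sum_const, smul_eq_mul, ← Set.ncard_eq_toFinset_card _ hXfin]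
  exact (heven k).mul_right 3

end frameRow

/-- A cubic graph with a Kotzig-frame has an even double cover if every eulerian 3-row graph has an
amiable coloring. -/
theorem IsKotzigFrame.hasEvenDoubleCover
    (hrow : ∀ (s : ℕ) (R : Graph (Fin 3 × Fin s) β),
      R.IsThreeRow → R.columnQuotient.IsEulerian →
        ∃ (f : Fin 3 × Fin s → Fin 3) (g : β → Fin 3), R.IsAmiableColoring f g)
    (hG : G.IsCubic) (hne : V(G).Nonempty) (hF : G.IsKotzigFrame F) :
    G.HasEvenDoubleCover := by
  classical
  obtain ⟨s, j, c, r, hj, hjeven, hdeg, hconn⟩ := hF.exists_coloring hG hne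
  have hFG := hF.1.le
  obtain ⟨f, g, hf, hfg, hpar⟩ := hrow s (G.frameRow F j r) (frameRow_isThreeRow hG.1)
    (columnQuotient_frameRow_isEulerian hG hj hFG hjeven)
  -- In each column `f` permutes the three colors; this permutation recolors the frame edges of the
  -- component.
  have hfinj : ∀ k, Function.Injective fun i => f (i, k) := fun k i i' h => by
    by_contra hne
    exact hf k i i' hne h
  obtain ⟨c', hc'⟩ : ∃ c' : β → Fin 3, ∀ e x, F.Inc e x → c' e = f (c e, j x) := by
    refine ⟨fun e => if h : ∃ x, F.Inc e x then f (c e, j h.choose) else 0, fun e x hx => ?_⟩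
    have hex : ∃ x, F.Inc e x := ⟨x, hx⟩
    simp only [dif_pos hex]
    by_cases h : hex.choose = x
    · rw [h]
    · rw [hj e _ _ (isLink_of_inc_of_inc hex.choose_spec hx h)]
  obtain ⟨g', hg'⟩ : ∃ g' : β → Fin 3, ∀ m, (∀ x, m ∉ E(F) → G.Inc m x → g' m ≠ f (r x, j x)) ∧
      (m ∈ E(G.frameRow F j r) → g' m = g m) := by
    have : ∀ m, ∃ k : Fin 3, (∀ x, m ∉ E(F) → G.Inc m x → k ≠ f (r x, j x)) ∧
        (m ∈ E(G.frameRow F j r) → k = g m) := by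
      intro m
      by_cases hm : m ∈ E(G) ∧ m ∉ E(F)
      · obtain ⟨x, y, hxy⟩ := exists_isLink_of_mem_edgeSet hm.1
        by_cases hjxy : j x = j y
        -- An edge within one component is absent from the 3-row graph and only has to avoid the
        -- frame colors at its two ends.
        · obtain ⟨k, hk1, hk2⟩ := (by decide : ∀ a b : Fin 3, ∃ k, k ≠ a ∧ k ≠ b)
            (f (r x, j x)) (f (r y, j y))
          refine ⟨k, fun z _ hz => ?_, ?_⟩
          · obtain rfl | rfl := hz.eq_or_eq_of_isLink hxy
            exacts [hk1, hk2]
          · rintro ⟨p, q, x', y', h, -, hne, -⟩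
            obtain ⟨rfl, rfl⟩ | ⟨rfl, rfl⟩ := hxy.eq_and_eq_or_eq_and_eq h
            exacts [absurd hjxy hne, absurd hjxy.symm hne]
        · refine ⟨g m, fun z _ hz => ?_, fun _ => rfl⟩
          refine (hfg m (r z, j z) (frameRow_inc_iff.2 ?_)).symm
          obtain rfl | rfl := hz.eq_or_eq_of_isLink hxy
          exacts [⟨_, _, hxy, hm.2, hjxy, rfl⟩, ⟨_, _, hxy.symm, hm.2, Ne.symm hjxy, rfl⟩]
      · refine ⟨g m, fun x hmF hmx => absurd ⟨hmx.edge_mem, hmF⟩ hm, fun _ => rfl⟩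
    choose g' hg' using this
    exact ⟨g', hg'⟩
  have hdeg2 : ∀ x ∈ V(G), 2 ≤ (F.incidenceSet x).ncard := fun x hx => by
    rcases hdeg x hx with h | h <;> omega
  refine hasEvenDoubleCover_of_colorings hG hFG j c' g' (fun x hx => ?_) ?_ fun i k => ?_
  · refine (hdeg x hx).imp (fun h => ⟨h.1, f (r x, j x), fun e he => ?_, fun m hm hmx => ?_⟩)
      fun h => ⟨h.1, fun e e' he he' hee => ?_⟩
    · rw [hc' e x he, h.2 e he]
    · exact (hg' m).1 x hm hmx
    · rw [hc' e x he, hc' e' x he']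
      exact fun h' => h.2 e e' he he' hee (hfinj _ h')
  · intro i x y d e hxy hd hdi he hei
    -- The new color `i` is the old color `i₀` throughout this component, so the old two-colored
    -- walk serves.
    obtain ⟨i₀, rfl⟩ := Finite.surjective_of_injective (hfinj (j x)) i
    have h1 : ∀ d z, F.Inc d z → j z = j x → (c' d ≠ f (i₀, j x) ↔ c d ≠ i₀) := by
      intro d z hz hzx
      rw [hc' d z hz, hzx]
      exact not_congr (hfinj (j x)).eq_iff
    have h2 := hconn i₀ x y d e hxy hd ((h1 d x hd rfl).1 hdi) he ((h1 e y he hxy.symm).1 hei)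
    refine reflTransGen_adj_mono ?_ h2
    refine ⟨le_rfl, ?_⟩
    rintro b z w ⟨⟨hb, z', hz', hjz'⟩, hbz⟩
    exact ⟨(h1 b z' hz' hjz').2 hb, hbz⟩
  · have hXfin : {x | x ∈ V(G) ∧ j x = k}.Finite := hG.1.1.subset fun x hx => hx.1
    -- Both the number of color-`i` ends in the component and the color degree sum of its column
    -- have the parity of the color-`i` part of one and the same cut; edges inside the component
    -- contribute two ends.
    have hR := even_sum_edgeDegree_iff (frameRow_isFinite (F := F) (j := j) (r := r) hG.1)
      (frameRow_loopless hG.1) {e | g e = i} (Finset.univ ×ˢ {k})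
    simp only [Finset.sum_product, Finset.sum_singleton] at hR
    have hGX := even_sum_edgeDegree_iff hG.1 hG.2.1 {m | m ∉ E(F) ∧ g' m = i} hXfin.toFinset
    rw [hXfin.coe_toFinset] at hGX
    have hcut : {m | m ∉ E(F) ∧ g' m = i} ∩ G.edgeCut {x | x ∈ V(G) ∧ j x = k} =
        {e | g e = i} ∩ (G.frameRow F j r).edgeCut (Finset.univ ×ˢ {k} :
          Finset (Fin 3 × Fin s)) := by
      rw [edgeCut_column hj hFG]
      ext m
      constructor
      · rintro ⟨⟨hm, hgm⟩, x, y, h, -, hne, rfl⟩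
        have hlink : (G.frameRow F j r).IsLink m (r x, j x) (r y, j y) :=
          ⟨x, y, h, hm, hne, rfl, rfl⟩
        refine ⟨((hg' m).2 hlink.edge_mem).symm.trans hgm, _, ?_, _, ?_, hlink⟩
        · simp
        · simp [hne]
      · rintro ⟨hgm, p, hp, q, hq, hlink⟩
        have hgg := (hg' m).2 hlink.edge_mem
        obtain ⟨x, y, h, hm, hne, rfl, rfl⟩ := hlink
        refine ⟨⟨hm, hgg.trans hgm⟩, x, y, h, hm, hne, ?_⟩
        simpa [eq_comm] using hp
    rw [hcut, ← hR] at hGX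
    have hsum : ∑ x ∈ hXfin.toFinset, G.edgeDegree {m | m ∉ E(F) ∧ g' m = i} x =
        {x | (∃ m ∉ E(F), G.Inc m x ∧ g' m = i) ∧ j x = k}.ncard := by
      have h1 : {x | (∃ m ∉ E(F), G.Inc m x ∧ g' m = i) ∧ j x = k} =
          (hXfin.toFinset.filter fun x => ∃ m ∉ E(F), G.Inc m x ∧ g' m = i : Finset α) := by
        ext x
        simp only [Finset.coe_filter, hXfin.mem_toFinset, Set.mem_ofPred_eq]
        constructor
        · rintro ⟨⟨m, hm, hmx, hgm⟩, hk⟩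
          exact ⟨⟨hmx.vertex_mem, hk⟩, m, hm, hmx, hgm⟩
        · rintro ⟨⟨-, hk⟩, h⟩
          exact ⟨h, hk⟩
      rw [h1, Set.ncard_coe_finset, Finset.card_filter]
      refine Finset.sum_congr rfl fun x hx => ?_
      split_ifs with h
      · obtain ⟨m, hm, hmx, hgm⟩ := h
        rw [edgeDegree, Set.ncard_eq_one]
        refine ⟨m, Set.eq_singleton_iff_unique_mem.2 ⟨⟨⟨hm, hgm⟩, hmx⟩, ?_⟩⟩
        rintro m' ⟨⟨hm', -⟩, hmx'⟩
        exact (inc_unique_of_notMem hG hFG (hdeg2 x hmx.vertex_mem) hm' hmx' hm hmx).1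
      · rw [edgeDegree, Set.ncard_eq_zero (finite_setOf_inc hG.1 _ _),
          Set.eq_empty_iff_forall_notMem]
        rintro m ⟨⟨hm, hgm⟩, hmx⟩
        exact h ⟨m, hm, hmx, hgm⟩
    have hcol : ∀ a, (G.frameRow F j r).edgeDegree {e | g e = i} (a, k) =
        (G.frameRow F j r).colorDegree g i (a, k) := by
      intro a
      unfold edgeDegree colorDegree
      congr 1
      ext e
      exact and_comm
    rw [← hsum, hGX, Finset.sum_congr rfl fun a _ => hcol a]
    exact hpar i k

/-! ### Gluing even double covers along small edge cuts -/

/-- The edges with an end in `Y` have a double cover by edge sets that are even on `Y`. -/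
def HasSideCover (G : Graph α β) (Y : Set α) : Prop :=
  ∃ (ι : Type) (_ : Finite ι) (Z : ι → Set β), (∀ i, ∀ e ∈ Z i, ∃ y ∈ Y, G.Inc e y) ∧
    (∀ i, ∀ y ∈ Y, Even (G.edgeDegree (Z i) y)) ∧
    ∀ e, (∃ y ∈ Y, G.Inc e y) → {i | e ∈ Z i}.ncard = 2

lemma edgeCut_sdiff (G : Graph α β) (X : Set α) : G.edgeCut (V(G) \ X) = G.edgeCut X := by
  ext e
  constructor
  · rintro ⟨x, hx, y, hy, h⟩
    exact ⟨y, by_contra fun hyX => hy ⟨h.right_mem, hyX⟩, x, hx.2, h.symm⟩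
  · rintro ⟨x, hx, y, hy, h⟩
    exact ⟨y, ⟨h.right_mem, hy⟩, x, fun h' => h'.2 hx, h.symm⟩

lemma eq_pair_of_subset {γ : Type*} {S : Set γ} {a b c : γ} (hab : a ≠ b) (hac : a ≠ c)
    (hbc : b ≠ c) (hS : S ⊆ {a, b, c}) (heven : Even S.ncard) :
    c ∈ S ↔ ¬ (a ∈ S ↔ b ∈ S) := by
  classical
  have h : S = (({a, b, c} : Finset γ).filter (· ∈ S) : Finset γ) := by
    ext x
    simp only [Finset.coe_filter, Finset.mem_insert, Finset.mem_singleton, Set.mem_ofPred_eq]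
    exact ⟨fun hx => ⟨hS hx, hx⟩, fun hx => hx.2⟩
  rw [h, Set.ncard_coe_finset, Finset.card_filter, Finset.sum_insert (by simp [hab, hac]),
    Finset.sum_insert (by simp [hbc]), Finset.sum_singleton] at heven
  by_cases ha : a ∈ S <;> by_cases hb : b ∈ S <;> by_cases hc : c ∈ S <;>
    simp [ha, hb, hc, Nat.even_iff] at heven ⊢

/-- If even traces on a set of two or three elements cover each element twice, then the number of
occurrences of each nonempty trace is determined. -/
lemma ncard_trace {γ : Type*} {ι : Type} [Finite ι] {Z : ι → Set γ} {D : Set γ}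
    (hD : D.ncard = 2 ∨ D.ncard = 3) (heven : ∀ i, Even (Z i ∩ D).ncard)
    (hcov : ∀ e ∈ D, {i | e ∈ Z i}.ncard = 2) {P : Set γ} (hP : P.Nonempty) :
    (P ⊆ D ∧ P.ncard = 2 → {i | Z i ∩ D = P}.ncard = 4 - D.ncard) ∧
    (¬ (P ⊆ D ∧ P.ncard = 2) → {i | Z i ∩ D = P}.ncard = 0) := by
  have hDfin : D.Finite := Set.finite_of_ncard_ne_zero (by omega)
  have htwo : ∀ i, (Z i ∩ D).Nonempty → (Z i ∩ D).ncard = 2 := by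
    intro i hi
    have h1 := (Set.ncard_pos (hDfin.inter_of_right (Z i))).2 hi
    have h2 := Set.ncard_le_ncard (Set.inter_subset_right : Z i ∩ D ⊆ D) hDfin
    obtain ⟨k, hk⟩ := heven i
    omega
  constructor
  · rintro ⟨hPD, hP2⟩
    obtain ⟨a, b, hab, rfl⟩ := Set.ncard_eq_two.1 hP2
    have haD : a ∈ D := hPD (Set.mem_insert _ _)
    have hbD : b ∈ D := hPD (Set.mem_insert_of_mem _ rfl)
    rcases hD with hD | hD
    · have hDab : D = {a, b} :=
        (Set.eq_of_subset_of_ncard_le hPD (by rw [hD, hP2]) hDfin).symm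
      rw [hD]
      show _ = 2
      rw [← hcov a haD]
      congr 1
      ext i
      constructor
      · intro hi
        have : a ∈ Z i ∩ D := by
          rw [show Z i ∩ D = {a, b} from hi]
          exact Set.mem_insert _ _
        exact this.1
      · intro hi
        rw [← hDab]
        exact Set.eq_of_subset_of_ncard_le Set.inter_subset_right
          (by rw [hD, htwo i ⟨a, hi, haD⟩]) hDfin
    · obtain ⟨c, hc⟩ : (D \ {a, b}).Nonempty := by
        rw [← Set.ncard_pos (hDfin.sdiff), Set.ncard_sdiff hPD, hP2, hD]
        omega
      have hac : a ≠ c := fun h => hc.2 (h ▸ Set.mem_insert _ _)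
      have hbc : b ≠ c := fun h => hc.2 (h ▸ Set.mem_insert_of_mem _ rfl)
      have hDabc : D = {a, b, c} := by
        symm
        refine Set.eq_of_subset_of_ncard_le ?_ ?_ hDfin
        · rintro x (rfl | rfl | rfl)
          exacts [haD, hbD, hc.1]
        · rw [hD, Set.ncard_insert_of_notMem (by simp [hab, hac]), Set.ncard_pair hbc]
      have hci : ∀ i, c ∈ Z i ↔ ¬ (a ∈ Z i ↔ b ∈ Z i) := by
        intro i
        have := eq_pair_of_subset hab hac hbc (hDabc ▸ Set.inter_subset_right : Z i ∩ D ⊆ _)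
          (heven i)
        simpa only [Set.mem_inter_iff, haD, hbD, hc.1, and_true] using this
      have hset : {i | Z i ∩ D = {a, b}} = {i | a ∈ Z i} ∩ {i | b ∈ Z i} := by
        ext i
        constructor
        · intro hi
          have h : ∀ x ∈ ({a, b} : Set γ), x ∈ Z i := fun x hx =>
            ((show Z i ∩ D = {a, b} from hi) ▸ hx : x ∈ Z i ∩ D).1
          exact ⟨h a (Set.mem_insert _ _), h b (Set.mem_insert_of_mem _ rfl)⟩
        · rintro ⟨ha, hb⟩
          have hnc : c ∉ Z i := fun h => (hci i).1 h (iff_of_true ha hb)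
          show Z i ∩ D = {a, b}
          ext x
          rw [hDabc]
          constructor
          · rintro ⟨hx, rfl | rfl | rfl⟩
            exacts [Set.mem_insert _ _, Set.mem_insert_of_mem _ rfl, absurd hx hnc]
          · rintro (rfl | rfl)
            exacts [⟨ha, Set.mem_insert _ _⟩, ⟨hb, Set.mem_insert_of_mem _ (Set.mem_insert _ _)⟩]
      -- Even traces make the members through `c` the symmetric difference of those through `a` and
      -- those through `b`. All three sets have size 2, so exactly one member contains both `a` and
      -- `b`.
      have hC : {i | c ∈ Z i} = ({i | a ∈ Z i} \ {i | b ∈ Z i}) ∪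
          ({i | b ∈ Z i} \ {i | a ∈ Z i}) := by
        ext i
        have := hci i
        simp only [Set.mem_union, Set.mem_sdiff, Set.mem_ofPred_eq]
        tauto
      have h1 := hcov c hc.1
      rw [hC, Set.ncard_union_eq (Set.disjoint_left.2 fun i hi hi' => hi.2 hi'.1)
        (Set.toFinite _) (Set.toFinite _)] at h1
      have h2 := Set.ncard_inter_add_ncard_sdiff_eq_ncard {i | a ∈ Z i} {i | b ∈ Z i}
        (Set.toFinite _)
      have h3 := Set.ncard_inter_add_ncard_sdiff_eq_ncard {i | b ∈ Z i} {i | a ∈ Z i}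
        (Set.toFinite _)
      rw [Set.inter_comm] at h3
      rw [hcov a haD] at h2
      rw [hcov b hbD] at h3
      rw [hset, hD]
      omega
  · intro hnot
    rw [Set.ncard_eq_zero (Set.toFinite _), Set.eq_empty_iff_forall_notMem]
    rintro i rfl
    exact hnot ⟨Set.inter_subset_right, htwo i hP⟩

/-- Two finite families with the same number of occurrences of each nonempty trace on `D` can be
given a common index type, up to empty members, such that their traces coincide. -/
lemma exists_common_index {γ : Type*} {ι κ : Type} [Finite ι] [Finite κ] (Z : ι → Set γ)
    (Z' : κ → Set γ) (D : Set γ)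
    (h : ∀ P : Set γ, P.Nonempty → {i | Z i ∩ D = P}.ncard = {k | Z' k ∩ D = P}.ncard) :
    ∃ (τ : Type) (_ : Finite τ) (Y Y' : τ → Set γ),
      (∀ t, Y t = ∅ ∨ ∃ i, Y t = Z i) ∧ (∀ t, Y' t = ∅ ∨ ∃ k, Y' t = Z' k) ∧
      (∀ e, {t | e ∈ Y t}.ncard = {i | e ∈ Z i}.ncard) ∧
      (∀ e, {t | e ∈ Y' t}.ncard = {k | e ∈ Z' k}.ncard) ∧ ∀ t, Y t ∩ D = Y' t ∩ D := by
  classical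
  -- Equal counts give a bijection for each nonempty trace; together these form the matching `σ`.
  have hfib : ∀ P : Set γ, Nonempty ({i : {i // (Z i ∩ D).Nonempty} // Z i ∩ D = P} ≃
      {k : {k // (Z' k ∩ D).Nonempty} // Z' k ∩ D = P}) := by
    intro P
    by_cases hP : P.Nonempty
    · rw [← Finite.card_eq]
      have h1 := Nat.card_congr (Equiv.subtypeSubtypeEquivSubtype
        (p := fun i => (Z i ∩ D).Nonempty) (q := fun i => Z i ∩ D = P) fun hx => hx ▸ hP)
      have h2 := Nat.card_congr (Equiv.subtypeSubtypeEquivSubtype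
        (p := fun i => (Z' i ∩ D).Nonempty) (q := fun i => Z' i ∩ D = P) fun hx => hx ▸ hP)
      rw [h1, h2]
      exact h P hP
    · have h1 : IsEmpty {i : {i // (Z i ∩ D).Nonempty} // Z i ∩ D = P} :=
        ⟨fun i => hP (i.2 ▸ i.1.2)⟩
      have h2 : IsEmpty {i : {i // (Z' i ∩ D).Nonempty} // Z' i ∩ D = P} :=
        ⟨fun i => hP (i.2 ▸ i.1.2)⟩
      exact ⟨Equiv.equivOfIsEmpty _ _⟩
  obtain ⟨σ, hσ⟩ : ∃ σ : {i // (Z i ∩ D).Nonempty} ≃ {k // (Z' k ∩ D).Nonempty},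
      ∀ i, Z' (σ i) ∩ D = Z i ∩ D := by
    refine ⟨Equiv.ofFiberEquiv (f := fun i : {i // (Z i ∩ D).Nonempty} => Z i ∩ D)
      (g := fun k : {k // (Z' k ∩ D).Nonempty} => Z' k ∩ D)
      fun P => (hfib P).some, fun i => ?_⟩
    exact Equiv.ofFiberEquiv_map (f := fun i : {i // (Z i ∩ D).Nonempty} => Z i ∩ D)
      (g := fun k : {k // (Z' k ∩ D).Nonempty} => Z' k ∩ D) _ i
  have hcount : ∀ {ι' τ : Type} [Finite τ] (X : ι' → Set γ) (Y : τ → Set γ) (ρ : ι' → τ),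
      Function.Injective ρ → (∀ i, Y (ρ i) = X i) → (∀ t, (∃ i, ρ i = t) ∨ Y t = ∅) →
      ∀ e, {t | e ∈ Y t}.ncard = {i | e ∈ X i}.ncard := by
    intro ι' τ _ X Y ρ hρ hY hr e
    rw [← Set.ncard_image_of_injective _ hρ]
    congr 1
    ext t
    constructor
    · intro ht
      rcases hr t with ⟨i, rfl⟩ | h0
      · rw [Set.mem_ofPred_eq, hY] at ht
        exact ⟨i, ht, rfl⟩
      · rw [Set.mem_ofPred_eq, h0] at ht
        exact absurd ht (Set.notMem_empty _)
    · rintro ⟨i, hi, rfl⟩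
      rw [Set.mem_ofPred_eq, hY]
      exact hi
  -- Matched members share an index; a member that misses `D` is paired with the empty set on the
  -- other side.
  refine ⟨{i // (Z i ∩ D).Nonempty} ⊕ ({i // ¬ (Z i ∩ D).Nonempty} ⊕ {k // ¬ (Z' k ∩ D).Nonempty}),
    inferInstance, Sum.elim (fun i => Z i) (Sum.elim (fun i => Z i) fun _ => ∅),
    Sum.elim (fun i => Z' (σ i)) (Sum.elim (fun _ => ∅) fun k => Z' k), ?_, ?_, ?_, ?_, ?_⟩
  · rintro (i | i | k)
    exacts [Or.inr ⟨i, rfl⟩, Or.inr ⟨i, rfl⟩, Or.inl rfl]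
  · rintro (i | i | k)
    exacts [Or.inr ⟨σ i, rfl⟩, Or.inl rfl, Or.inr ⟨k, rfl⟩]
  · refine hcount Z _ (fun i => if h : (Z i ∩ D).Nonempty then .inl ⟨i, h⟩
      else .inr (.inl ⟨i, h⟩)) ?_ ?_ ?_
    · intro i i' h
      by_cases h1 : (Z i ∩ D).Nonempty <;> by_cases h2 : (Z i' ∩ D).Nonempty <;>
        simp [h1, h2] at h <;> exact h
    · intro i
      by_cases h1 : (Z i ∩ D).Nonempty <;> simp [h1]
    · rintro (i | i | k)
      exacts [Or.inl ⟨i, by simp [i.2]⟩, Or.inl ⟨i, by simp [i.2]⟩, Or.inr rfl]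
  · refine hcount Z' _ (fun k => if h : (Z' k ∩ D).Nonempty then .inl (σ.symm ⟨k, h⟩)
      else .inr (.inr ⟨k, h⟩)) ?_ ?_ ?_
    · intro i i' h
      by_cases h1 : (Z' i ∩ D).Nonempty <;> by_cases h2 : (Z' i' ∩ D).Nonempty <;>
        simp [h1, h2] at h <;> exact h
    · intro i
      by_cases h1 : (Z' i ∩ D).Nonempty <;> simp [h1]
    · rintro (i | i | k)
      exacts [Or.inl ⟨σ i, by simp [(σ i).2]⟩, Or.inr rfl, Or.inl ⟨k, by simp [k.2]⟩]
  · rintro (i | i | k)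
    · exact (hσ i).symm
    · simpa using Set.not_nonempty_iff_eq_empty.1 i.2
    · simpa using (Set.not_nonempty_iff_eq_empty.1 k.2).symm

lemma mem_edgeCut_of_inc {X : Set α} {e : β} {x y : α} (hx : x ∈ X)
    (hex : G.Inc e x) (hy : y ∉ X) (hey : G.Inc e y) : e ∈ G.edgeCut X :=
  ⟨x, hx, y, hy, isLink_of_inc_of_inc hex hey (by rintro rfl; exact hy hx)⟩

/-- Even double covers of the two sides of an edge cut of size 2 or 3 can be glued. -/
theorem HasSideCover.hasEvenDoubleCover (hG : G.IsCubic) {X : Set α} (hX : X ⊆ V(G))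
    (hD : (G.edgeCut X).ncard = 2 ∨ (G.edgeCut X).ncard = 3) (h : G.HasSideCover X)
    (h' : G.HasSideCover (V(G) \ X)) : G.HasEvenDoubleCover := by
  obtain ⟨ι, _, Z, hZ, hZe, hZc⟩ := h
  obtain ⟨κ, _, Z', hZ', hZe', hZc'⟩ := h'
  have hcutX : ∀ e ∈ G.edgeCut X, (∃ x ∈ X, G.Inc e x) ∧ ∃ y ∈ V(G) \ X, G.Inc e y := by
    rintro e ⟨x, hx, y, hy, h⟩
    exact ⟨⟨x, hx, h.inc_left⟩, y, ⟨h.right_mem, hy⟩, h.inc_right⟩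
  have heZ : ∀ i, Even (Z i ∩ G.edgeCut X).ncard := fun i =>
    even_ncard_inter_edgeCut hG.1 hG.2.1 hX (hZe i)
  have heZ' : ∀ k, Even (Z' k ∩ G.edgeCut X).ncard := fun k => by
    rw [← edgeCut_sdiff G X]
    exact even_ncard_inter_edgeCut hG.1 hG.2.1 Set.sdiff_subset (hZe' k)
  obtain ⟨τ, _, Y, Y', hY, hY', hYc, hYc', htr⟩ := exists_common_index Z Z' (G.edgeCut X) (by
    intro P hP
    have h1 := ncard_trace hD heZ (fun e he => hZc e (hcutX e he).1) hP
    have h2 := ncard_trace hD heZ' (fun e he => hZc' e (hcutX e he).2) hP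
    by_cases hPD : P ⊆ G.edgeCut X ∧ P.ncard = 2
    · rw [h1.1 hPD, h2.1 hPD]
    · rw [h1.2 hPD, h2.2 hPD])
  have hYinc : ∀ t, ∀ e ∈ Y t, ∃ x ∈ X, G.Inc e x := by
    intro t e he
    rcases hY t with h0 | ⟨i, hi⟩
    · rw [h0] at he
      exact absurd he (Set.notMem_empty _)
    · exact hZ i e (hi ▸ he)
  have hYinc' : ∀ t, ∀ e ∈ Y' t, ∃ x ∈ V(G) \ X, G.Inc e x := by
    intro t e he
    rcases hY' t with h0 | ⟨i, hi⟩
    · rw [h0] at he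
      exact absurd he (Set.notMem_empty _)
    · exact hZ' i e (hi ▸ he)
  have hYe : ∀ t, ∀ x ∈ X, Even (G.edgeDegree (Y t) x) := by
    intro t x hx
    rcases hY t with h0 | ⟨i, hi⟩
    · simp [h0, edgeDegree]
    · rw [hi]; exact hZe i x hx
  have hYe' : ∀ t, ∀ x ∈ V(G) \ X, Even (G.edgeDegree (Y' t) x) := by
    intro t x hx
    rcases hY' t with h0 | ⟨i, hi⟩
    · simp [h0, edgeDegree]
    · rw [hi]; exact hZe' i x hx
  -- An edge of `Y' t` with an end in `X` crosses the cut, where the traces agree. Hence the union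
  -- looks like `Y t` at vertices of `X`.
  have hmem : ∀ t e x, x ∈ X → G.Inc e x → (e ∈ Y t ∪ Y' t ↔ e ∈ Y t) := by
    intro t e x hx hex
    refine ⟨?_, Or.inl⟩
    rintro (he | he)
    · exact he
    · obtain ⟨y, hy, hey⟩ := hYinc' t e he
      have : e ∈ Y' t ∩ G.edgeCut X := ⟨he, mem_edgeCut_of_inc hx hex hy.2 hey⟩
      rw [← htr] at this
      exact this.1
  have hmem' : ∀ t e x, x ∈ V(G) \ X → G.Inc e x → (e ∈ Y t ∪ Y' t ↔ e ∈ Y' t) := by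
    intro t e x hx hex
    refine ⟨?_, Or.inr⟩
    rintro (he | he)
    · obtain ⟨y, hy, hey⟩ := hYinc t e he
      have : e ∈ Y t ∩ G.edgeCut X := ⟨he, mem_edgeCut_of_inc hy hey hx.2 hex⟩
      rw [htr] at this
      exact this.1
    · exact he
  refine ⟨τ, inferInstance, fun t => Y t ∪ Y' t, ?_, ?_, ?_⟩
  · rintro t e (he | he)
    · obtain ⟨x, -, hx⟩ := hYinc t e he
      exact hx.edge_mem
    · obtain ⟨x, -, hx⟩ := hYinc' t e he
      exact hx.edge_mem
  · intro t x hx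
    by_cases hxX : x ∈ X
    · rw [show G.edgeDegree (Y t ∪ Y' t) x = G.edgeDegree (Y t) x from ?_]
      · exact hYe t x hxX
      · unfold edgeDegree
        congr 1
        ext e
        exact and_congr_left fun he => hmem t e x hxX he
    · rw [show G.edgeDegree (Y t ∪ Y' t) x = G.edgeDegree (Y' t) x from ?_]
      · exact hYe' t x ⟨hx, hxX⟩
      · unfold edgeDegree
        congr 1
        ext e
        exact and_congr_left fun he => hmem' t e x ⟨hx, hxX⟩ he
  · intro e he
    obtain ⟨x, y, hxy⟩ := exists_isLink_of_mem_edgeSet he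
    by_cases hxX : x ∈ X
    · rw [← hZc e ⟨x, hxX, hxy.inc_left⟩, ← hYc]
      congr 1
      ext t
      exact hmem t e x hxX hxy.inc_left
    · rw [← hZc' e ⟨x, ⟨hxy.left_mem, hxX⟩, hxy.inc_left⟩, ← hYc']
      congr 1
      ext t
      exact hmem' t e x ⟨hxy.left_mem, hxX⟩ hxy.inc_left

/-! ### Reduction to cyclically 4-edge-connected graphs -/

/-- `G` is nonempty, and each edge cut with nonempty sides has at least two edges. -/
def IsTwoEdgeConnected (G : Graph α β) : Prop :=
  V(G).Nonempty ∧ ∀ X ⊆ V(G), X.Nonempty → (V(G) \ X).Nonempty → 2 ≤ (G.edgeCut X).ncard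

/-- No edge leaves a component. -/
lemma IsTwoEdgeConnected.isConnected (h : G.IsTwoEdgeConnected) : G.IsConnected := by
  refine ⟨h.1, fun x hx y hy => ?_⟩
  by_contra hxy
  have h2 := h.2 V(G.componentAt x) (fun z hz => hz.1) ⟨x, self_mem_componentAt hx⟩
    ⟨y, hy, fun hy' => hxy hy'.2⟩
  obtain ⟨e, p, hp, q, hq, hpq⟩ : (G.edgeCut V(G.componentAt x)).Nonempty :=
    Set.nonempty_of_ncard_ne_zero (by omega)
  exact hq ((isLink_componentAt_iff hp).2 hpq).right_mem

/-- An end `x` of a bridge has degree 3 and hence a neighbor `z` on its own side. Deleting `x` would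
separate `z` from the other end of the bridge. -/
lemma IsTwoConnected.isTwoEdgeConnected (hG : G.IsCubic) (h : G.IsTwoConnected) :
    G.IsTwoEdgeConnected := by
  refine ⟨h.1.1, fun X hX hXne hYne => ?_⟩
  have hcross : ∀ (H : Graph α β) (S : Set α) (x y : α), Relation.ReflTransGen H.Adj x y → x ∈ S →
      y ∉ S → ∃ e, ∃ a ∈ S, ∃ b ∉ S, H.IsLink e a b := by
    intro H S x y hxy hx hy
    induction hxy with
    | refl => exact absurd hx hy
    | @tail b c _ hbc ih =>
      by_cases hb : b ∈ S
      · obtain ⟨e, he⟩ := hbc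
        exact ⟨e, b, hb, c, hy, he⟩
      · exact ih hb
  have hfin : (G.edgeCut X).Finite := hG.1.2.subset (edgeCut_subset_edgeSet G X)
  obtain ⟨p, hp⟩ := hXne
  obtain ⟨q, hq⟩ := hYne
  obtain ⟨e, x, hx, y, hy, he⟩ := hcross G X p q (h.1.2 p (hX hp) q hq.1) hp hq.2
  by_contra hlt
  have huniq : ∀ f ∈ G.edgeCut X, f = e := fun f hf =>
    (Set.ncard_le_one hfin).1 (by omega) f hf e ⟨x, hx, y, hy, he⟩
  have hx3 := hG.ncard_incidenceSet he.left_mem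
  obtain ⟨f, hf, hfe⟩ : ∃ f ∈ G.incidenceSet x, f ≠ e :=
    Set.exists_ne_of_one_lt_ncard (by omega) e
  obtain ⟨z, hz⟩ := hf
  have hzX : z ∈ X := by
    by_contra hzX
    exact hfe (huniq f ⟨x, hx, z, hzX, hz⟩)
  have hzx : z ≠ x := (hz.ne_of_loopless hG.2.1).symm
  have hyx : y ≠ x := (he.ne_of_loopless hG.2.1).symm
  obtain ⟨d, a, ha, b, hb, hd⟩ := hcross _ X z y
    ((h.2 x he.left_mem).2 z ⟨hz.right_mem, hzx⟩ y ⟨he.right_mem, hyx⟩) hzX hy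
  rw [deleteVerts_isLink] at hd
  have hde := huniq d ⟨a, ha, b, hb, hd.1⟩
  subst hde
  obtain ⟨rfl, rfl⟩ | ⟨rfl, rfl⟩ := he.eq_and_eq_or_eq_and_eq hd.1
  exacts [hd.2.1 rfl, hb hx]

/-- A side of an edge cut inherits a cover from a smaller graph whose edges at the vertices of the
side correspond to those of `G`. -/
lemma HasEvenDoubleCover.hasSideCover {H : Graph α β} {Y : Set α} (h : H.HasEvenDoubleCover)
    (hY : Y ⊆ V(H)) (φ : β → β)
    (hinc : ∀ y ∈ Y, H.incidenceSet y = φ '' G.incidenceSet y)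
    (hinj : ∀ y ∈ Y, Set.InjOn φ (G.incidenceSet y)) : G.HasSideCover Y := by
  obtain ⟨ι, _, Z, hZ, hZe, hZc⟩ := h
  have hmem : ∀ y ∈ Y, ∀ e, G.Inc e y → H.Inc (φ e) y := fun y hy e he => by
    have : φ e ∈ H.incidenceSet y := hinc y hy ▸ Set.mem_image_of_mem φ he
    exact this
  refine ⟨ι, inferInstance, fun i => {e | φ e ∈ Z i ∧ ∃ y ∈ Y, G.Inc e y}, fun i e he => he.2,
    fun i y hy => ?_, fun e he => ?_⟩
  · have h1 := hZe i y (hY hy)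
    convert! h1 using 1
    unfold edgeDegree
    rw [← Set.InjOn.ncard_image (f := φ)]
    · congr 1
      ext e
      constructor
      · rintro ⟨f, ⟨⟨hf, -⟩, hfy⟩, rfl⟩
        exact ⟨hf, hmem y hy f hfy⟩
      · rintro ⟨he, hey⟩
        have : e ∈ φ '' G.incidenceSet y := hinc y hy ▸ hey
        obtain ⟨f, hf, rfl⟩ := this
        exact ⟨f, ⟨⟨he, y, hy, hf⟩, hf⟩, rfl⟩
    · exact (hinj y hy).mono fun e he => he.2
  · obtain ⟨y, hy, hey⟩ := he
    rw [← hZc (φ e) (hmem y hy e hey).edge_mem]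
    congr 1
    ext i
    exact ⟨fun h => h.1, fun h => ⟨h, y, hy, hey⟩⟩

open scoped Classical in
/-- The graph obtained from `G` by contracting the complement of `Y` to the vertex `z`. -/
noncomputable def contractCompl (G : Graph α β) (Y : Set α) (z : α) : Graph α β where
  vertexSet := insert z Y
  IsLink e p q := ∃ x y, G.IsLink e x y ∧ (x ∈ Y ∨ y ∈ Y) ∧ p = (if x ∈ Y then x else z) ∧
    q = if y ∈ Y then y else z
  isLink_symm e _ := ⟨by
    rintro p q ⟨x, y, h, hxy, hp, hq⟩
    exact ⟨y, x, h.symm, hxy.symm, hq, hp⟩⟩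
  eq_or_eq_of_isLink_of_isLink := by
    rintro e p q p' q' ⟨x, y, h, -, rfl, rfl⟩ ⟨x', y', h', -, rfl, rfl⟩
    obtain rfl | rfl := h.left_eq_or_eq h'
    exacts [Or.inl rfl, Or.inr rfl]
  left_mem_of_isLink := by
    rintro e p q ⟨x, y, h, -, rfl, rfl⟩
    split_ifs with hx
    exacts [Set.mem_insert_of_mem _ hx, Set.mem_insert _ _]

/-! ### Closing up a side of a 3-edge cut by a vertex -/

section contractCompl

variable {Y : Set α} {z : α}

lemma contractCompl_incidenceSet (hz : z ∉ Y) {y : α} (hy : y ∈ Y) :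
    (G.contractCompl Y z).incidenceSet y = G.incidenceSet y := by
  classical
  ext e
  constructor
  · rintro ⟨q, x, y', h, -, hxy, -⟩
    split_ifs at hxy with hx
    · exact hxy ▸ h.inc_left
    · exact absurd (hxy ▸ hy) hz
  · rintro ⟨q, h⟩
    exact ⟨_, y, q, h, Or.inl hy, by rw [if_pos hy], rfl⟩

lemma contractCompl_incidenceSet_self (hz : z ∉ Y) :
    (G.contractCompl Y z).incidenceSet z = G.edgeCut Y := by
  classical
  ext e
  constructor
  · rintro ⟨q, x, y, h, hxy, hx, -⟩
    split_ifs at hx with hxY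
    · exact absurd (hx ▸ hxY) hz
    · exact ⟨y, hxy.resolve_left hxY, x, hxY, h.symm⟩
  · rintro ⟨x, hx, y, hy, h⟩
    exact ⟨_, y, x, h.symm, Or.inr hx, by rw [if_neg hy], rfl⟩

lemma contractCompl_edgeSet_subset : E(G.contractCompl Y z) ⊆ E(G) := by
  rintro e ⟨p, q, x, y, h, -⟩
  exact h.edge_mem

/-- The new vertex meets exactly the three cut edges. Edges with no end in `Y` are discarded, so
contraction creates no loops. -/
lemma contractCompl_isCubic (hG : G.IsCubic) (hY : Y ⊆ V(G)) (hz : z ∉ Y)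
    (hcut : (G.edgeCut Y).ncard = 3) : (G.contractCompl Y z).IsCubic := by
  classical
  have hl : (G.contractCompl Y z).Loopless := by
    refine ⟨?_⟩
    rintro e p ⟨x, y, h, hxy, hx, hy⟩
    have hne := h.ne_of_loopless hG.2.1
    split_ifs at hx hy with h1 h2 h2
    · exact hne (hx.symm.trans hy)
    · exact hz ((hy.symm.trans hx) ▸ h1)
    · exact hz ((hx.symm.trans hy) ▸ h2)
    · exact hxy.elim h1 h2
  refine ⟨⟨(hG.1.1.subset hY).insert z, hG.1.2.subset contractCompl_edgeSet_subset⟩, hl, ?_⟩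
  intro y hy
  rw [degree_eq_ncard_incidenceSet hl]
  rcases hy with rfl | hy
  · rw [contractCompl_incidenceSet_self hz, hcut]
  · rw [contractCompl_incidenceSet hz hy, hG.ncard_incidenceSet (hY hy)]

/-- Every edge cut of the contraction is the edge cut of a preimage in `G`. -/
lemma contractCompl_isTwoEdgeConnected (hG : G.IsTwoEdgeConnected) (hY : Y ⊆ V(G))
    (hz : z ∈ V(G) \ Y) : (G.contractCompl Y z).IsTwoEdgeConnected := by
  classical
  have hmap : ∀ p ∈ insert z Y, (if p ∈ Y then p else z) = p := by
    rintro p (rfl | hp)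
    exacts [if_neg hz.2, if_pos hp]
  have hsub : insert z Y ⊆ V(G) := Set.insert_subset hz.1 hY
  refine ⟨⟨z, Set.mem_insert _ _⟩, fun A hA hAne hAc => ?_⟩
  have hcut : (G.contractCompl Y z).edgeCut A =
      G.edgeCut {v | v ∈ V(G) ∧ (if v ∈ Y then v else z) ∈ A} := by
    ext e
    constructor
    · rintro ⟨p, hp, q, hq, x, y, h, hxy, rfl, rfl⟩
      exact ⟨x, ⟨h.left_mem, hp⟩, y, fun hy => hq hy.2, h⟩
    · rintro ⟨x, ⟨hx, hxA⟩, y, hy, h⟩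
      have hyA : (if y ∈ Y then y else z) ∉ A := fun h' => hy ⟨h.right_mem, h'⟩
      refine ⟨_, hxA, _, hyA, x, y, h, ?_, rfl, rfl⟩
      by_contra! hcon
      rw [if_neg hcon.1] at hxA
      rw [if_neg hcon.2] at hyA
      exact hyA hxA
  rw [hcut]
  obtain ⟨a, ha⟩ := hAne
  obtain ⟨b, hb, hbA⟩ := hAc
  refine hG.2 _ (fun v hv => hv.1) ⟨a, hsub (hA ha), ?_⟩ ⟨b, hsub hb, fun h => hbA ?_⟩
  · rw [hmap a (hA ha)]; exact ha
  · rw [← hmap b hb]; exact h.2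

end contractCompl

/-- The graph obtained from the subgraph of `G` induced by `Y` by adding an edge `d` between the
distinct vertices `a` and `b`. -/
def induceAddEdge (G : Graph α β) (Y : Set α) (d : β) (a b : α) (ha : a ∈ Y) (hb : b ∈ Y)
    (hd : ∀ x ∈ Y, ∀ y ∈ Y, ¬ G.IsLink d x y) : Graph α β where
  vertexSet := Y
  IsLink e p q := (G.IsLink e p q ∧ p ∈ Y ∧ q ∈ Y) ∨ (e = d ∧ (p = a ∧ q = b ∨ p = b ∧ q = a))
  isLink_symm e _ := ⟨by
    rintro p q (⟨h, hp, hq⟩ | ⟨rfl, h⟩)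
    · exact Or.inl ⟨h.symm, hq, hp⟩
    · exact Or.inr ⟨rfl, by tauto⟩⟩
  eq_or_eq_of_isLink_of_isLink := by
    rintro e p q p' q' (⟨h, hp, hq⟩ | ⟨rfl, h⟩) (⟨h', hp', hq'⟩ | ⟨h2, h'⟩)
    · exact h.left_eq_or_eq h'
    · subst h2
      exact absurd h (hd p hp q hq)
    · exact absurd h' (hd p' hp' q' hq')
    · rcases h with ⟨rfl, rfl⟩ | ⟨rfl, rfl⟩ <;> rcases h' with ⟨rfl, rfl⟩ | ⟨rfl, rfl⟩ <;> simp
  left_mem_of_isLink := by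
    rintro e p q (⟨h, hp, hq⟩ | ⟨rfl, ⟨rfl, rfl⟩ | ⟨rfl, rfl⟩⟩)
    exacts [hp, ha, hb]

/-! ### Closing up a side of a 2-edge cut by an edge -/

section twoCut

variable {Y : Set α} {d d' : β} {a b : α}

lemma not_isLink_of_mem_edgeCut (hd : d ∈ G.edgeCut Y) : ∀ x ∈ Y, ∀ y ∈ Y, ¬ G.IsLink d x y := by
  intro x hx y hy h
  rw [mem_edgeCut_iff h] at hd
  tauto

/-- The two edges of an edge cut of size 2 have distinct ends on each side. -/
lemma ne_of_edgeCut_eq_pair (hG : G.IsCubic) (h2 : G.IsTwoEdgeConnected) (hY : Y ⊆ V(G))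
    (hne : (V(G) \ Y).Nonempty) (hYt : Y.Nontrivial) (hcut : G.edgeCut Y = {d, d'})
    (hdd : d ≠ d') (ha : a ∈ Y) (hda : G.Inc d a) (hdb : G.Inc d' b) : a ≠ b := by
  rintro rfl
  -- If both cut edges met `a`, only the third edge at `a` could leave `Y \ {a}`, contrary to
  -- 2-edge-connectedness.
  have hsub : G.edgeCut (Y \ {a}) ⊆ G.incidenceSet a \ {d, d'} := by
    rintro e ⟨x, ⟨hx, hxa⟩, y, hy, h⟩
    have hy' : y = a := by
      by_contra hya
      have hyY : y ∉ Y := fun hyY => hy ⟨hyY, hya⟩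
      have he : e ∈ G.edgeCut Y := ⟨x, hx, y, hyY, h⟩
      have hinc : G.Inc e a := by
        rw [hcut] at he
        rcases he with rfl | rfl
        exacts [hda, hdb]
      rcases hinc.eq_or_eq_of_isLink h with rfl | rfl
      exacts [hxa rfl, hya rfl]
    subst hy'
    refine ⟨h.inc_right, fun he => ?_⟩
    rw [← hcut] at he
    exact not_isLink_of_mem_edgeCut he x hx y ha h
  have hfin : (G.incidenceSet a).Finite := hG.1.2.subset (incidenceSet_subset_edgeSet a)
  have h3 := Set.ncard_le_ncard hsub hfin.sdiff
  rw [Set.ncard_sdiff (by rintro e (rfl | rfl); exacts [hda, hdb]), Set.ncard_pair hdd,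
    hG.ncard_incidenceSet (hY ha)] at h3
  obtain ⟨y, hy, hya⟩ := hYt.exists_ne a
  obtain ⟨x, hx⟩ := hne
  have h4 := h2.2 (Y \ {a}) (Set.sdiff_subset.trans hY) ⟨y, hy, hya⟩ ⟨x, hx.1, fun h => hx.2 h.1⟩
  omega

lemma induceAddEdge_inc_iff {ha : a ∈ Y} {hb : b ∈ Y}
    {hd : ∀ x ∈ Y, ∀ y ∈ Y, ¬ G.IsLink d x y} {e : β} {y : α} (hy : y ∈ Y) :
    (G.induceAddEdge Y d a b ha hb hd).Inc e y ↔
      (∃ x ∈ Y, G.IsLink e y x) ∨ (e = d ∧ (y = a ∨ y = b)) := by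
  constructor
  · rintro ⟨q, ⟨h, -, hq⟩ | ⟨rfl, h⟩⟩
    · exact Or.inl ⟨q, hq, h⟩
    · exact Or.inr ⟨rfl, by tauto⟩
  · rintro (⟨x, hx, h⟩ | ⟨rfl, rfl | rfl⟩)
    exacts [⟨x, Or.inl ⟨h, hy, hx⟩⟩, ⟨b, Or.inr ⟨rfl, by tauto⟩⟩, ⟨a, Or.inr ⟨rfl, by tauto⟩⟩]

-- The added edge reuses the name `d`, and it replaces both cut edges, so `d'` is renamed to `d`.
-- The renaming is injective at each vertex because `d` and `d'` have different ends in `Y`.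
open scoped Classical in
lemma induceAddEdge_incidenceSet (hcut : G.edgeCut Y = {d, d'}) (hdd : d ≠ d') (hab : a ≠ b)
    (ha : a ∈ Y) (hb : b ∈ Y) (hda : G.Inc d a) (hdb : G.Inc d' b)
    (hd : ∀ x ∈ Y, ∀ y ∈ Y, ¬ G.IsLink d x y) {y : α} (hy : y ∈ Y) :
    (G.induceAddEdge Y d a b ha hb hd).incidenceSet y =
        (fun e => if e = d' then d else e) '' G.incidenceSet y ∧
      Set.InjOn (fun e => if e = d' then d else e) (G.incidenceSet y) := by
  have hmem : ∀ e x, e ∈ G.edgeCut Y → G.Inc e x → G.Inc e y → x ∈ Y → y = x := by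
    intro e x he hex hey hx
    by_contra hne
    exact not_isLink_of_mem_edgeCut he y hy x hx (isLink_of_inc_of_inc hey hex hne)
  have hdc : d ∈ G.edgeCut Y := hcut ▸ Set.mem_insert _ _
  have hdc' : d' ∈ G.edgeCut Y := hcut ▸ Set.mem_insert_of_mem _ rfl
  have hinY : ∀ e, e ≠ d → e ≠ d' → (G.Inc e y ↔ ∃ x ∈ Y, G.IsLink e y x) := by
    intro e h1 h2
    refine ⟨?_, fun ⟨x, _, h⟩ => h.inc_left⟩
    rintro ⟨x, h⟩
    refine ⟨x, by_contra fun hx => ?_, h⟩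
    have : e ∈ G.edgeCut Y := ⟨y, hy, x, hx, h⟩
    rw [hcut] at this
    exact this.elim h1 h2
  constructor
  · ext e
    rw [mem_incidenceSet, induceAddEdge_inc_iff hy]
    constructor
    · rintro (⟨x, hx, h⟩ | ⟨rfl, rfl | rfl⟩)
      · refine ⟨e, h.inc_left, if_neg ?_⟩
        rintro rfl
        exact not_isLink_of_mem_edgeCut hdc' y hy x hx h
      · exact ⟨e, hda, if_neg hdd⟩
      · exact ⟨d', hdb, if_pos rfl⟩
    · rintro ⟨f, hf, rfl⟩
      by_cases hfd' : f = d'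
      · subst hfd'
        simp only [if_true]
        exact Or.inr ⟨trivial, Or.inr (hmem f b hdc' hdb hf hb)⟩
      · simp only [if_neg hfd']
        by_cases hfd : f = d
        · subst hfd
          exact Or.inr ⟨rfl, Or.inl (hmem f a hdc hda hf ha)⟩
        · exact Or.inl ((hinY f hfd hfd').1 hf)
  · have hnot : ¬ (G.Inc d y ∧ G.Inc d' y) := fun h =>
      hab ((hmem d a hdc hda h.1 ha).symm.trans (hmem d' b hdc' hdb h.2 hb))
    intro e he f hf hef
    have he : G.Inc e y := he
    have hf : G.Inc f y := hf
    simp only at hef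
    split_ifs at hef with h1 h2 h2
    · exact h1.trans h2.symm
    · subst h1; subst hef; exact absurd ⟨hf, he⟩ hnot
    · subst h2; subst hef; exact absurd ⟨he, hf⟩ hnot
    · exact hef

lemma induceAddEdge_isCubic (hG : G.IsCubic) (hY : Y ⊆ V(G)) (hcut : G.edgeCut Y = {d, d'})
    (hdd : d ≠ d') (hab : a ≠ b) (ha : a ∈ Y) (hb : b ∈ Y) (hda : G.Inc d a) (hdb : G.Inc d' b)
    (hd : ∀ x ∈ Y, ∀ y ∈ Y, ¬ G.IsLink d x y) :
    (G.induceAddEdge Y d a b ha hb hd).IsCubic := by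
  classical
  have hl : (G.induceAddEdge Y d a b ha hb hd).Loopless := by
    refine ⟨?_⟩
    rintro e p (⟨h, -, -⟩ | ⟨-, ⟨rfl, h⟩ | ⟨rfl, h⟩⟩)
    exacts [not_isLink_self hG.2.1 h, hab h, hab h.symm]
  refine ⟨⟨hG.1.1.subset hY, hG.1.2.subset ?_⟩, hl, fun y hy => ?_⟩
  · rintro e ⟨p, q, ⟨h, -, -⟩ | ⟨rfl, -⟩⟩
    exacts [h.edge_mem, hda.edge_mem]
  · obtain ⟨h1, h2⟩ := induceAddEdge_incidenceSet hcut hdd hab ha hb hda hdb hd hy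
    rw [degree_eq_ncard_incidenceSet hl, h1, h2.ncard_image, hG.ncard_incidenceSet (hY hy)]

/-- Passing to the complement, assume `b ∉ A`. Then `d'` does not meet `A`, and `d` crosses in
either graph exactly if `a ∈ A`, so the cut of `A` is the same in both. -/
lemma induceAddEdge_isTwoEdgeConnected (h2 : G.IsTwoEdgeConnected) (hY : Y ⊆ V(G))
    (hne : (V(G) \ Y).Nonempty) (hcut : G.edgeCut Y = {d, d'})
    (ha : a ∈ Y) (hb : b ∈ Y) (hda : G.Inc d a) (hdb : G.Inc d' b)
    (hd : ∀ x ∈ Y, ∀ y ∈ Y, ¬ G.IsLink d x y) :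
    (G.induceAddEdge Y d a b ha hb hd).IsTwoEdgeConnected := by
  obtain ⟨z, hz⟩ := hne
  have key : ∀ A ⊆ Y, b ∉ A → A.Nonempty →
      2 ≤ ((G.induceAddEdge Y d a b ha hb hd).edgeCut A).ncard := by
    intro A hA hbA hAne
    have heq : (G.induceAddEdge Y d a b ha hb hd).edgeCut A = G.edgeCut A := by
      ext e
      constructor
      · rintro ⟨p, hp, q, hq, ⟨h, -, -⟩ | ⟨rfl, ⟨rfl, rfl⟩ | ⟨rfl, rfl⟩⟩⟩
        · exact ⟨p, hp, q, hq, h⟩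
        · obtain ⟨x, hx⟩ := hda
          exact ⟨p, hp, x, fun hxA => hd p ha x (hA hxA) hx, hx⟩
        · exact absurd hp hbA
      · rintro ⟨p, hp, q, hq, h⟩
        by_cases hqY : q ∈ Y
        · exact ⟨p, hp, q, hq, Or.inl ⟨h, hA hp, hqY⟩⟩
        · have he : e ∈ G.edgeCut Y := ⟨p, hA hp, q, hqY, h⟩
          have hmem : ∀ x ∈ Y, G.Inc e x → p = x := fun x hx hex =>
            (hex.eq_or_eq_of_isLink h).elim Eq.symm fun hxq => absurd (hxq ▸ hx) hqY
          rw [hcut] at he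
          rcases he with rfl | rfl
          · have := hmem a ha hda
            subst this
            exact ⟨p, hp, b, hbA, Or.inr ⟨rfl, Or.inl ⟨rfl, rfl⟩⟩⟩
          · exact absurd (hmem b hb hdb ▸ hp) hbA
    rw [heq]
    exact h2.2 A (hA.trans hY) hAne ⟨z, hz.1, fun h => hz.2 (hA h)⟩
  refine ⟨⟨a, ha⟩, fun A hA hAne hAc => ?_⟩
  by_cases hbA : b ∈ A
  · rw [← edgeCut_sdiff]
    exact key _ Set.sdiff_subset (fun h => h.2 hbA) hAc
  · exact key A hA hbA hAne

end twoCut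

/-- If all smaller graphs have even double covers, then so do the sides of an edge cut with two or
three edges. -/
lemma hasSideCover_of_smaller (hG : G.IsCubic) (h2 : G.IsTwoEdgeConnected)
    (ih : ∀ H : Graph α β, H.IsCubic → H.IsTwoEdgeConnected → V(H).ncard < V(G).ncard →
      H.HasEvenDoubleCover) {Y : Set α} (hY : Y ⊆ V(G)) (hYt : Y.Nontrivial)
    (hYc : (V(G) \ Y).Nontrivial)
    (hcut : (G.edgeCut Y).ncard = 2 ∨ (G.edgeCut Y).ncard = 3) : G.HasSideCover Y := by
  classical
  have hYfin := hG.1.1.subset hY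
  have hcard : Y.ncard + (V(G) \ Y).ncard = V(G).ncard := by
    rw [Set.ncard_sdiff hY hYfin]
    have := Set.ncard_le_ncard hY hG.1.1
    omega
  have := (hG.1.1.sdiff (t := Y)).to_subtype
  -- The contraction replaces the complement by one vertex, so two vertices there make it smaller
  -- than `G`.
  have hgt : 1 < (V(G) \ Y).ncard := Set.one_lt_ncard_iff_nontrivial.2 hYc
  obtain ⟨z, hz⟩ := hYc.nonempty
  rcases hcut with hcut | hcut
  · obtain ⟨d, d', hdd, hD⟩ := Set.ncard_eq_two.1 hcut
    obtain ⟨a, ha, x, hx, hda⟩ : d ∈ G.edgeCut Y := hD ▸ Set.mem_insert _ _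
    obtain ⟨b, hb, y, hy, hdb⟩ : d' ∈ G.edgeCut Y := hD ▸ Set.mem_insert_of_mem _ rfl
    have hd := not_isLink_of_mem_edgeCut (hD ▸ Set.mem_insert _ _ : d ∈ G.edgeCut Y)
    have hab := ne_of_edgeCut_eq_pair hG h2 hY ⟨z, hz⟩ hYt hD hdd ha hda.inc_left hdb.inc_left
    refine (ih (G.induceAddEdge Y d a b ha hb hd)
      (induceAddEdge_isCubic hG hY hD hdd hab ha hb hda.inc_left hdb.inc_left hd)
      (induceAddEdge_isTwoEdgeConnected h2 hY ⟨z, hz⟩ hD ha hb hda.inc_left hdb.inc_left hd)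
      ?_).hasSideCover subset_rfl (fun e => if e = d' then d else e)
      (fun y hy => (induceAddEdge_incidenceSet hD hdd hab ha hb hda.inc_left hdb.inc_left hd hy).1)
      (fun y hy => (induceAddEdge_incidenceSet hD hdd hab ha hb hda.inc_left hdb.inc_left hd hy).2)
    show Y.ncard < _
    omega
  · refine (ih (G.contractCompl Y z) (contractCompl_isCubic hG hY hz.2 hcut)
      (contractCompl_isTwoEdgeConnected h2 hY hz) ?_).hasSideCover (Set.subset_insert _ _) id
      (fun y hy => ?_) (fun y _ => Function.injective_id.injOn)
    · show (insert z Y).ncard < _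
      rw [Set.ncard_insert_of_notMem hz.2 hYfin]
      omega
    · rw [contractCompl_incidenceSet hz.2 hy, Set.image_id]

lemma IsCycle.nontrivial {C : Graph α β} (hC : C.IsCycle) (hl : C.Loopless) :
    V(C).Nontrivial := by
  obtain ⟨x, hx⟩ := hC.2.1.1
  have h2 := hC.2.2 x hx
  rw [degree_eq_ncard_incidenceSet hl] at h2
  obtain ⟨e, y, hxy⟩ : (C.incidenceSet x).Nonempty := Set.nonempty_of_ncard_ne_zero (by omega)
  exact ⟨x, hx, y, hxy.right_mem, hxy.ne_of_loopless hl⟩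

/-- If the cyclically 4-edge-connected cubic graphs have even double covers, then so do all
2-edge-connected cubic graphs. -/
theorem IsTwoEdgeConnected.hasEvenDoubleCover
    (h4 : ∀ G : Graph α β, G.IsCubic → G.IsCyclicallyEdgeConnected 4 → G.HasEvenDoubleCover)
    (hG : G.IsCubic) (h2 : G.IsTwoEdgeConnected) : G.HasEvenDoubleCover := by
  induction hn : V(G).ncard using Nat.strong_induction_on generalizing G with
  | _ n ih =>
    subst hn
    by_cases hcyc : G.IsCyclicallyEdgeConnected 4
    · exact h4 G hG hcyc
    have ih' : ∀ H : Graph α β, H.IsCubic → H.IsTwoEdgeConnected → V(H).ncard < V(G).ncard →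
      H.HasEvenDoubleCover := fun H hH hH2 hlt => ih _ hlt hH hH2 rfl
    have : ¬ ∀ X ⊆ V(G), (∃ C ≤ G, C.IsCycle ∧ V(C) ⊆ X) →
        (∃ C ≤ G, C.IsCycle ∧ V(C) ⊆ V(G) \ X) → 4 ≤ (G.edgeCut X).ncard :=
      fun h => hcyc ⟨h2.isConnected, h⟩
    push Not at this
    obtain ⟨X, hX, ⟨C, hC, hCc, hCX⟩, ⟨C', hC', hCc', hCX'⟩, hlt⟩ := this
    -- The cycles serve only to put two vertices on each side.
    have hXt := (hCc.nontrivial (loopless_of_le hG.2.1 hC)).mono hCX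
    have hXt' := (hCc'.nontrivial (loopless_of_le hG.2.1 hC')).mono hCX'
    have hge := h2.2 X hX hXt.nonempty hXt'.nonempty
    have hcut : (G.edgeCut X).ncard = 2 ∨ (G.edgeCut X).ncard = 3 := by omega
    refine (hasSideCover_of_smaller hG h2 ih' hX hXt hXt' hcut).hasEvenDoubleCover hG hX hcut
      (hasSideCover_of_smaller hG h2 ih' Set.sdiff_subset hXt' ?_ ?_)
    · rwa [Set.sdiff_sdiff_cancel_left hX]
    · rwa [edgeCut_sdiff]

end Graph

theorem corollary3
    (hrow : ∀ (s : ℕ) (β : Type v) (R : Graph (Fin 3 × Fin s) β),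
      R.IsThreeRow → R.columnQuotient.IsEulerian →
        ∃ (f : Fin 3 × Fin s → Fin 3) (g : β → Fin 3), R.IsAmiableColoring f g)
    (hframe : ∀ (α : Type u) (β : Type v) (G : Graph α β),
      G.IsCubic → G.IsCyclicallyEdgeConnected 4 → ∃ F : Graph α β, G.IsKotzigFrame F) :
    ∀ (α : Type u) (β : Type v) (G : Graph α β),
      G.IsCubic → G.IsTwoConnected → ∃ S : Set (Graph α β), G.IsCycleDoubleCover S := by
  intro α β G hG hconn
  refine Graph.HasEvenDoubleCover.exists_isCycleDoubleCover hG
    (Graph.IsTwoEdgeConnected.hasEvenDoubleCover (fun H hH h4 => ?_) hG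
      (hconn.isTwoEdgeConnected hG))
  obtain ⟨F, hF⟩ := hframe α β H hH h4
  exact hF.hasEvenDoubleCover (fun s R => hrow s β R) hH h4.1.1
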